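/- Notation. $(a;q)_\infty=\prod_{j\ge0}(1-aq^j)$. An overpartition is a partition in which the first occurrence of each part may be overlined. For a nonempty partition or overpartition $\pi$, $l(\pi)$ is its largest part and $\#(\pi)$ its number of parts. For $m\in\mathbb Z$, $n\ge 1$: (i) $N2(m,n)$ is the number of partitions $\pi$ of $n$ without repeated odd parts with $M_2$-rank $\lceil l(\pi)/2\rceil-\#(\pi)=m$; (ii) $\overline N(m,n)$ is the number of overpartitions $\pi$ of $n$ with Dyson rank $l(\pi)-\#(\pi)=m$; (iii) $\overline{N2}(m,n)$ is the number of overpartitions $\pi$ of $n$ with $M_2$-rank $\lceil l(\pi)/2\rceil-\#(\pi)+\#(\pi_o)-\chi(\pi)=m$, where $\#(\pi_o)$ is the number of odd non-overlined parts of $\pi$, and $\chi(\pi)=1$ if the largest part is odd and no occurrence of it is overlined, $\chi(\pi)=0$ otherwise; (iv) the (residual) crank numbers $M2(m,n)$, $\overline M(m,n)$, $\overline{M2}(m,n)$ are the coefficients of $z^mq^n$ in, respectively, $$\frac{(-q;q^2)_\infty(q^2;q^2)_\infty}{(zq^2;q^2)_\infty(z^{-1}q^2;q^2)_\infty},\qquad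 \frac{(-q;q)_\infty(q;q)_\infty}{(zq;q)_\infty(z^{-1}q;q)_\infty},\qquad \frac{(-q;q)_\infty(q^2;q^2)_\infty}{(q;q^2)_\infty(zq^2;q^2)_\infty(z^{-1}q^2;q^2)_\infty}.$$ For $A:\mathbb Z\to\mathbb Z$ with finite support put $\sigma_j(A)=\sum_{m\in\mathbb Z}\binom{m+\lfloor (j-1)/2\rfloor}{j}A(m)$ (polynomial binomial coefficients), and define the higher-order spt functions $$\mathrm{M2spt}_k(n)=\sigma_{2k}(M2(\cdot,n))-\sigma_{2k}(N2(\cdot,n)),\quad \overline{\mathrm{spt}}_k(n)=\sigma_{2k}(\overline M(\cdot,n))-\sigma_{2k}(\overline N(\cdot,n)),\quad \overline{\mathrm{spt}2}_k(n)=\sigma_{2k}(\overline{M2}(\cdot,n))-\sigma_{2k}(\overline{N2}(\cdot,n)).$$ Let $S2$ be the set of partition pairs $(\pi_1,\pi_2)$ with $\pi_1$ having only even parts and $\pi_2$ only distinct odd parts; $\overline S$ the set of partition pairs $(\pi_1,\pi_2)$ with $\pi_2$ having distinct parts; $\overline{S2}$ the set of vector partitions $(\pi_1,\pi_2,\pi_3)$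 with $\pi_1$ having only even parts, $\pi_2$ only odd parts and $\pi_3$ distinct parts; in all three cases it is required that the smallest part of the vector occurs in $\pi_1$ and in no other component. (So these are the partitions with smallest part even and no repeated odd parts, the overpartitions with smallest part not overlined, and the overpartitions with smallest part even and not overlined.) $|\vec\pi|$ is the sum of all parts. If $n_1<n_2<\dots<n_d$ are the different parts of $\pi_1$, let $f_j$ be the number of occurrences of $n_j$ in $\pi_1$ ($f_j=0$ for $j>d$), and for $k\ge1$ let $$\omega_k(\vec\pi)=\sum_{\substack{m_1+\dots+m_r=k\\ r\ge 1,\ m_i\ge1}}\binom{f_1+m_1-1}{2m_1-1}\sum_{2\le j_2<\dots<j_r}\ \prod_{i=2}^r\binom{f_{j_i}+m_i}{2m_i}.$$ Theorem. For all $k\ge1$ and $n\ge1$, $$\mathrm{M2spt}_k(n)=\sum_{\vec\pi\in S2,\ |\vec\pi|=n}\omega_k(\vec\pi),\qquad \overline{\mathrm{spt}}_k(n)=\sum_{\vec\pi\in\overline S,\ |\vec\pi|=n}\omega_k(\vec\pi),\qquad \overline{\mathrm{spt}2}_k(n)=\sum_{\vec\pi\in\overline{S2},\ |\vec\pi|=n}\omega_k(\vec\pi).$$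 In particular, for all $n\ge1$, $\mathrm{M2spt}_1(n)$, $\overline{\mathrm{spt}}_1(n)$ and $\overline{\mathrm{spt}2}_1(n)$ equal the total number of occurrences of the smallest part in, respectively, the partitions of $n$ with smallest part even and without repeated odd parts, the overpartitions of $n$ with smallest part not overlined, and the overpartitions of $n$ with smallest part even and not overlined. -/

import Mathlib

open scoped LaurentPolynomial PowerSeries

namespace HigherSpt

/-! ### Partitions and vector partitions -/

/-- The partitions of `n`, as multisets of positive integers with sum `n`. -/
def partitionsOf (n : ℕ) : Finset (Multiset ℕ) :=
  (Finset.univ : Finset n.Partition).image Nat.Partition.parts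

theorem mem_partitionsOf {n : ℕ} {s : Multiset ℕ} :
    s ∈ partitionsOf n ↔ (∀ i ∈ s, 0 < i) ∧ s.sum = n := by
  unfold partitionsOf
  simp only [Finset.mem_image, Finset.mem_univ, true_and]
  constructor
  · rintro ⟨p, rfl⟩
    exact ⟨fun i hi => p.parts_pos hi, p.parts_sum⟩
  · rintro ⟨h, hs⟩
    exact ⟨⟨s, fun {i} hi => h i hi, hs⟩, rfl⟩

/-- The partition pairs `(π₁, π₂)` of `n`. -/
def partitionPairs (n : ℕ) : Finset (Multiset ℕ × Multiset ℕ) :=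
  (Finset.HasAntidiagonal.antidiagonal n).biUnion fun x => partitionsOf x.1 ×ˢ partitionsOf x.2

theorem mem_partitionPairs {n : ℕ} {π : Multiset ℕ × Multiset ℕ} :
    π ∈ partitionPairs n ↔
      (∀ i ∈ π.1, 0 < i) ∧ (∀ i ∈ π.2, 0 < i) ∧ π.1.sum + π.2.sum = n := by
  unfold partitionPairs
  simp only [Finset.mem_biUnion, Finset.HasAntidiagonal.mem_antidiagonal, Finset.mem_product, mem_partitionsOf]
  constructor
  · rintro ⟨x, hx, ⟨h1, h2⟩, h3, h4⟩
    exact ⟨h1, h3, by rw [h2, h4, hx]⟩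
  · rintro ⟨h1, h2, h3⟩
    exact ⟨(π.1.sum, π.2.sum), h3, ⟨h1, rfl⟩, h2, rfl⟩

/-- The vector partitions `(π₁, π₂, π₃)` of `n`. -/
def partitionTriples (n : ℕ) : Finset (Multiset ℕ × Multiset ℕ × Multiset ℕ) :=
  (Finset.HasAntidiagonal.antidiagonal n).biUnion fun x => partitionsOf x.1 ×ˢ partitionPairs x.2

theorem mem_partitionTriples {n : ℕ} {π : Multiset ℕ × Multiset ℕ × Multiset ℕ} :
    π ∈ partitionTriples n ↔
      (∀ i ∈ π.1, 0 < i) ∧ (∀ i ∈ π.2.1, 0 < i) ∧ (∀ i ∈ π.2.2, 0 < i) ∧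
        π.1.sum + π.2.1.sum + π.2.2.sum = n := by
  unfold partitionTriples
  simp only [Finset.mem_biUnion, Finset.HasAntidiagonal.mem_antidiagonal, Finset.mem_product, mem_partitionsOf,
    mem_partitionPairs]
  constructor
  · rintro ⟨x, hx, ⟨h1, h2⟩, h3, h4, h5⟩
    exact ⟨h1, h3, h4, by omega⟩
  · rintro ⟨h1, h2, h3, h4⟩
    exact ⟨(π.1.sum, π.2.1.sum + π.2.2.sum), by simpa [add_assoc] using h4, ⟨h1, rfl⟩, h2, h3, rfl⟩

/-- The overpartitions of `n`, as pairs `(π₁, π₂)` of the partition `π₁` formed by the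
non-overlined parts and the partition `π₂` formed by the overlined parts; the latter is a
partition into distinct parts. -/
def overpartitions (n : ℕ) : Finset (Multiset ℕ × Multiset ℕ) :=
  (partitionPairs n).filter fun π => π.2.Nodup

/-- The partitions of `n` without repeated odd parts. -/
def distinctOddPartitions (n : ℕ) : Finset (Multiset ℕ) :=
  (partitionsOf n).filter fun s => ∀ i ∈ s, Odd i → s.count i = 1

/-- The `j`-th smallest different part `n_j` of a partition, `n_1 < n_2 < ... < n_m`
(and `0` for `j > m`). -/
def distinctPart (s : Multiset ℕ) (j : ℕ) : ℕ :=
  (s.toFinset.sort (· ≤ ·)).getD (j - 1) 0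

/-- The frequency `f_j` of the part `n_j` (and `0` if there are fewer than `j` different parts). -/
def freq (s : Multiset ℕ) (j : ℕ) : ℕ :=
  if j ≤ s.toFinset.card then s.count (distinctPart s j) else 0

/-- The smallest part of a (nonempty) partition. -/
def smallestPart (s : Multiset ℕ) : ℕ := distinctPart s 1

/-! ### Ranks -/

/-- Dyson rank of an overpartition: the largest part minus the number of parts. -/
def dysonRank (π : Multiset ℕ × Multiset ℕ) : ℤ :=
  ((π.1 + π.2).sup : ℤ) - (Multiset.card (π.1 + π.2) : ℤ)

/-- The `M₂`-rank `⌈l(π)/2⌉ - #(π)` of a partition without repeated odd parts. -/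
def m2Rank (s : Multiset ℕ) : ℤ :=
  ⌈(s.sup : ℚ) / 2⌉ - (Multiset.card s : ℤ)

/-- The `M₂`-rank `⌈l(π)/2⌉ - #(π) + #(π_o) - χ(π)` of an overpartition, where `π_o` consists of
the odd non-overlined parts, and `χ(π)` is `1` if the largest part is odd and non-overlined and `0`
otherwise. It is the first occurrence of a part that may be overlined, so the largest part counts
as overlined as soon as one occurrence of it is. -/
def m2RankOver (π : Multiset ℕ × Multiset ℕ) : ℤ :=
  ⌈((π.1 + π.2).sup : ℚ) / 2⌉ - (Multiset.card (π.1 + π.2) : ℤ)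
    + (Multiset.card (π.1.filter Odd) : ℤ)
    - (if Odd (π.1 + π.2).sup ∧ (π.1 + π.2).sup ∉ π.2 then 1 else 0)

/-- `N2(m,n)`: the number of partitions of `n` with distinct odd parts and `M₂`-rank `m`. -/
def N2 (m : ℤ) (n : ℕ) : ℤ :=
  (((distinctOddPartitions n).filter fun s => m2Rank s = m).card : ℤ)

/-- The number of overpartitions of `n` with Dyson rank `m`. -/
def NBar (m : ℤ) (n : ℕ) : ℤ :=
  (((overpartitions n).filter fun π => dysonRank π = m).card : ℤ)

/-- The number of overpartitions of `n` with `M₂`-rank `m`. -/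
def N2Bar (m : ℤ) (n : ℕ) : ℤ :=
  (((overpartitions n).filter fun π => m2RankOver π = m).card : ℤ)

/-! ### Cranks -/

/-- The finite product `(a; q)_n = ∏_{j < n} (1 - a q^j)`. -/
noncomputable def qPoch {R : Type*} [CommRing R] (a q : R⟦X⟧) (n : ℕ) : R⟦X⟧ :=
  ∏ j ∈ Finset.range n, (1 - a * q ^ j)

/-- The infinite product `(a; q)_∞ = ∏_{j ≥ 0} (1 - a q^j)` for a power series `q` without constant
term: its `n`-th coefficient is that of `(a; q)_N` for every `N > n`
(see `coeff_qPoch_eq_coeff_qPochInf`). -/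
noncomputable def qPochInf {R : Type*} [CommRing R] (a q : R⟦X⟧) : R⟦X⟧ :=
  PowerSeries.mk fun n => PowerSeries.coeff n (qPoch a q (n + 1))

theorem coeff_qPoch_eq_coeff_qPochInf {R : Type*} [CommRing R] (a q : R⟦X⟧)
    (hq : PowerSeries.X ∣ q) {n N : ℕ} (h : n < N) :
    PowerSeries.coeff n (qPoch a q N) = PowerSeries.coeff n (qPochInf a q) := by
  rw [qPochInf, PowerSeries.coeff_mk]
  induction N, h using Nat.le_induction with
  | base => rfl
  | succ N hN ih =>
    rw [qPoch, Finset.prod_range_succ, ← qPoch, mul_sub, mul_one, map_sub, ih]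
    have hd : (PowerSeries.X : R⟦X⟧) ^ N ∣ qPoch a q N * (a * q ^ N) :=
      ((pow_dvd_pow_of_dvd hq N).mul_left a).mul_left _
    rw [PowerSeries.X_pow_dvd_iff.1 hd n hN, sub_zero]

/-- The inverse of a power series with constant coefficient `1`. -/
noncomputable def psInv {R : Type*} [CommRing R] (F : R⟦X⟧) : R⟦X⟧ :=
  PowerSeries.invOfUnit F 1

theorem qPochInf_mul_psInv {R : Type*} [CommRing R] (a q : R⟦X⟧) (ha : PowerSeries.X ∣ a) :
    qPochInf a q * psInv (qPochInf a q) = 1 := by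
  apply PowerSeries.mul_invOfUnit
  have h0 : PowerSeries.constantCoeff a = 0 := PowerSeries.X_dvd_iff.1 ha
  rw [← PowerSeries.coeff_zero_eq_constantCoeff_apply, qPochInf, PowerSeries.coeff_mk]
  simp [qPoch, h0]

/-- The variable `q`, in the ring of power series in `q` over the Laurent polynomials in `z`. -/
noncomputable def q : ℤ[T;T⁻¹]⟦X⟧ := PowerSeries.X

/-- The variable `z`. -/
noncomputable def z : ℤ[T;T⁻¹]⟦X⟧ := PowerSeries.C (LaurentPolynomial.T 1)

/-- The element `z⁻¹`. -/
noncomputable def zInv : ℤ[T;T⁻¹]⟦X⟧ := PowerSeries.C (LaurentPolynomial.T (-1))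

/-- `(-q;q²)_∞ (q²;q²)_∞ / ((zq²;q²)_∞ (z⁻¹q²;q²)_∞)`. -/
noncomputable def crankSeries2 : ℤ[T;T⁻¹]⟦X⟧ :=
  qPochInf (-q) (q ^ 2) * qPochInf (q ^ 2) (q ^ 2)
    * psInv (qPochInf (z * q ^ 2) (q ^ 2)) * psInv (qPochInf (zInv * q ^ 2) (q ^ 2))

/-- `(-q;q)_∞ (q;q)_∞ / ((zq;q)_∞ (z⁻¹q;q)_∞)`. -/
noncomputable def crankSeriesBar : ℤ[T;T⁻¹]⟦X⟧ :=
  qPochInf (-q) q * qPochInf q q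
    * psInv (qPochInf (z * q) q) * psInv (qPochInf (zInv * q) q)

/-- `(-q;q)_∞ (q²;q²)_∞ / ((q;q²)_∞ (zq²;q²)_∞ (z⁻¹q²;q²)_∞)`. -/
noncomputable def crankSeries2Bar : ℤ[T;T⁻¹]⟦X⟧ :=
  qPochInf (-q) q * qPochInf (q ^ 2) (q ^ 2) * psInv (qPochInf q (q ^ 2))
    * psInv (qPochInf (z * q ^ 2) (q ^ 2)) * psInv (qPochInf (zInv * q ^ 2) (q ^ 2))

/-- The residual crank numbers `M2(m,n)` for partitions with distinct odd parts, given by their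
generating function `∑ M2(m,n) z^m q^n`. -/
noncomputable def M2 (m : ℤ) (n : ℕ) : ℤ := (PowerSeries.coeff n crankSeries2).coeff m

/-- The residual crank numbers for overpartitions, given by their generating function. -/
noncomputable def MBar (m : ℤ) (n : ℕ) : ℤ := (PowerSeries.coeff n crankSeriesBar).coeff m

/-- The second residual crank numbers for overpartitions, given by their generating function. -/
noncomputable def M2Bar (m : ℤ) (n : ℕ) : ℤ := (PowerSeries.coeff n crankSeries2Bar).coeff m

/-! ### Symmetrized moments and the higher order spt functions -/

/-- The symmetrized moment `∑_{m ∈ ℤ} binom(m + ⌊(j-1)/2⌋, j) A(m)` of a finitely supported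
`A : ℤ → ℤ`; the binomial coefficient is the usual polynomial one, also at negative integers. -/
noncomputable def symMoment (j : ℕ) (A : ℤ → ℤ) : ℤ :=
  ∑ᶠ m : ℤ, Ring.choose (m + ((j : ℤ) - 1) / 2) j * A m

theorem finite_support_card {α : Type*} (s : Finset α) (r : α → ℤ) :
    (Function.support fun m : ℤ => ((s.filter fun x => r x = m).card : ℤ)).Finite := by
  classical
  refine (s.image r).finite_toSet.subset fun m hm => ?_
  obtain ⟨x, hx⟩ := Finset.card_pos.1 (Nat.pos_of_ne_zero (Nat.cast_ne_zero.1 hm))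
  rw [Finset.mem_filter] at hx
  exact Finset.mem_coe.2 (Finset.mem_image.2 ⟨x, hx⟩)

theorem finite_support_N2 (n : ℕ) : (Function.support fun m => N2 m n).Finite :=
  finite_support_card _ _

theorem finite_support_NBar (n : ℕ) : (Function.support fun m => NBar m n).Finite :=
  finite_support_card _ _

theorem finite_support_N2Bar (n : ℕ) : (Function.support fun m => N2Bar m n).Finite :=
  finite_support_card _ _

theorem finite_support_M2 (n : ℕ) : (Function.support fun m => M2 m n).Finite :=
  (PowerSeries.coeff n crankSeries2).coeff.hasFiniteSupport

theorem finite_support_MBar (n : ℕ) : (Function.support fun m => MBar m n).Finite :=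
  (PowerSeries.coeff n crankSeriesBar).coeff.hasFiniteSupport

theorem finite_support_M2Bar (n : ℕ) : (Function.support fun m => M2Bar m n).Finite :=
  (PowerSeries.coeff n crankSeries2Bar).coeff.hasFiniteSupport

/-- `M2spt_k(n)`, the difference of the `2k`-th symmetrized crank and rank moments. -/
noncomputable def M2spt (k n : ℕ) : ℤ :=
  symMoment (2 * k) (fun m => M2 m n) - symMoment (2 * k) (fun m => N2 m n)

/-- The higher order spt function of overpartitions. -/
noncomputable def sptBar (k n : ℕ) : ℤ :=
  symMoment (2 * k) (fun m => MBar m n) - symMoment (2 * k) (fun m => NBar m n)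

/-- The higher order spt function of overpartitions with smallest part even. -/
noncomputable def sptBar2 (k n : ℕ) : ℤ :=
  symMoment (2 * k) (fun m => M2Bar m n) - symMoment (2 * k) (fun m => N2Bar m n)

/-! ### The classes of vector partitions and the weight -/

/-- The members of `S2` of size `n`: partitions with smallest part even and no repeated odd parts,
as pairs `(π₁, π₂)`, where `π₁` has only even parts, `π₂` has distinct odd parts, and the smallest
part occurs only in `π₁`. -/
def S2 (n : ℕ) : Finset (Multiset ℕ × Multiset ℕ) :=
  (partitionPairs n).filter fun π =>
    (∀ i ∈ π.1, Even i) ∧ (∀ i ∈ π.2, Odd i) ∧ π.2.Nodup ∧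
      ∃ a ∈ π.1.toFinset, (∀ b ∈ π.1, a ≤ b) ∧ ∀ b ∈ π.2, a < b

/-- The overpartitions of `n` with smallest part not overlined, as pairs of the non-overlined parts
`π₁` and the (distinct) overlined parts `π₂`, where the smallest part occurs only in `π₁`. -/
def SBar (n : ℕ) : Finset (Multiset ℕ × Multiset ℕ) :=
  (partitionPairs n).filter fun π =>
    π.2.Nodup ∧ ∃ a ∈ π.1.toFinset, (∀ b ∈ π.1, a ≤ b) ∧ ∀ b ∈ π.2, a < b

/-- The overpartitions of `n` with smallest part even and not overlined, as triples
`(π₁, π₂, π₃)` of the non-overlined even parts, the non-overlined odd parts, and the (distinct)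
overlined parts, where the smallest part occurs only in `π₁`. -/
def SBar2 (n : ℕ) : Finset (Multiset ℕ × Multiset ℕ × Multiset ℕ) :=
  (partitionTriples n).filter fun π =>
    (∀ i ∈ π.1, Even i) ∧ (∀ i ∈ π.2.1, Odd i) ∧ π.2.2.Nodup ∧
      ∃ a ∈ π.1.toFinset, (∀ b ∈ π.1, a ≤ b) ∧ (∀ b ∈ π.2.1, a < b) ∧ ∀ b ∈ π.2.2, a < b

/-- The `i`-th entry `m_i` of a composition `m_1 + ... + m_r = k`, for `1 ≤ i ≤ r`. -/
def entry {k : ℕ} (c : Composition k) (i : ℕ) : ℕ := c.blocks.getD (i - 1) 0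

/-- The weight `ω_k`, for `k ≥ 1`: the sum over the compositions `m_1 + ... + m_r = k` of
`binom(f_1 + m_1 - 1, 2 m_1 - 1)` times the sum over `2 ≤ j_2 < ... < j_r` of
`∏_{i = 2}^r binom(f_{j_i} + m_i, 2 m_i)`. As `f_j = 0` beyond the number of different parts, where
the binomial coefficient vanishes, the indices `j_i` range only up to that number. Here `j_i` is
written as `j t` with `t = i - 2`. -/
def omega (k : ℕ) (s : Multiset ℕ) : ℕ :=
  ∑ c : Composition k,
    (freq s 1 + entry c 1 - 1).choose (2 * entry c 1 - 1) *
      ∑ j ∈ (Fintype.piFinset fun _ : Fin (c.length - 1) =>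
          Finset.Icc 2 s.toFinset.card).filter (fun j => StrictMono j),
        ∏ t : Fin (c.length - 1),
          (freq s (j t) + entry c (t + 2)).choose (2 * entry c (t + 2))

/-! ### The ordinary smallest parts functions -/

/-- The number of smallest parts in the partitions of `n` without repeated odd parts and with
smallest part even. -/
def ordM2spt (n : ℕ) : ℕ :=
  ∑ s ∈ (distinctOddPartitions n).filter (fun s => Even (smallestPart s)),
    s.count (smallestPart s)

/-- The number of smallest parts in the overpartitions of `n` whose smallest part is not
overlined. -/
def ordSptBar (n : ℕ) : ℕ :=
  ∑ π ∈ (overpartitions n).filter (fun π => smallestPart (π.1 + π.2) ∉ π.2),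
    (π.1 + π.2).count (smallestPart (π.1 + π.2))

/-- The number of smallest parts in the overpartitions of `n` whose smallest part is even and not
overlined. -/
def ordSptBar2 (n : ℕ) : ℕ :=
  ∑ π ∈ (overpartitions n).filter (fun π =>
      Even (smallestPart (π.1 + π.2)) ∧ smallestPart (π.1 + π.2) ∉ π.2),
    (π.1 + π.2).count (smallestPart (π.1 + π.2))

end HigherSpt

namespace HigherSpt

/-! ### Infinite products modulo powers of `X`, and the identity crank − rank = spt. -/

section QSeries

open PowerSeries Finset

variable {R : Type*} [CommRing R]

/-! All three cases are one identity in a base Q and two parameters α, h, with w = z⁻¹. Let R_n =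
(αQ^n)_∞ (hQ^{n+1})_∞ / (αhQ^n)_∞ (`restSeries`) and U_n = R_n (Q^{n+1})_∞ / ((zQ^{n+1})_∞
(wQ^{n+1})_∞). For α = -q and (Q, h) = (q², 0), (q, 0), (q², -1), U_0 is the crank series of the
three families, and U_n tends to 1. Since (1 - zy)(1 - wy) + (z + w - 2)y = (1 - y)², the difference
U_n - U_{n+1} splits into an spt term, with the factor z + w - 2, and (1 - h)(Q - α) times the
general term of a ₃φ₂ series. A contiguous relation (`psi_step`), iterated, turns the latter series
into the one that generates the ranks. Hence the crank series minus the rank series is the sum of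
the spt terms (`crank_sub_rank`).

Put Y = z - 2 + z⁻¹. The functional that takes the 2k-th symmetrized moment of a Laurent polynomial
in z reads off the coefficient of Y^k from a polynomial in Y (`shiftMoment_aeval_yy`):
multiplication by Y acts on the binomial weights as a second central difference, which lowers the
order by 2.

In the spt term with index n, the smallest part i = c(n+1), for Q = q^c, contributes Y q^i / ((1 - z
q^i)(1 - z⁻¹ q^i)), and every larger multiple i of c contributes (1 - q^i) / ((1 - z q^i)(1 - z⁻¹
q^i)). Their coefficients of q^{if} are the polynomials `bPoly₁ f` and `bPoly f` in Y, whose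
coefficients are the binomials in ω_k. The factor R_{n+1} counts the remaining components. So the
coefficient of Y^k in the product over all parts is ω_k (`omega_eq_coeff`).

On the rank side, the objects are sorted by the exponent of z that comes from the largest part, and
the layers are matched with the terms of the transformed series (`rankSeries_of_h_zero`,
`rankSeries_of_h_neg_one`). For k = 1 the coefficient of Y is the multiplicity of the smallest part
(`omega_one`). -/

theorem eq_zero_of_forall_X_pow_dvd {F : R⟦X⟧} (h : ∀ N : ℕ, (X : R⟦X⟧) ^ N ∣ F) : F = 0 := by
  ext n
  simpa using X_pow_dvd_iff.1 (h (n + 1)) n (Nat.lt_succ_self n)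

theorem qPoch_zero (a Q : R⟦X⟧) : qPoch a Q 0 = 1 := by simp [qPoch]

theorem qPoch_succ (a Q : R⟦X⟧) (n : ℕ) :
    qPoch a Q (n + 1) = qPoch a Q n * (1 - a * Q ^ n) := Finset.prod_range_succ _ _

theorem qPoch_succ' (a Q : R⟦X⟧) (n : ℕ) :
    qPoch a Q (n + 1) = (1 - a) * qPoch (a * Q) Q n := by
  rw [qPoch, Finset.prod_range_succ', mul_comm, pow_zero, mul_one, qPoch]
  congr 1
  exact Finset.prod_congr rfl fun j _ => by ring

/-- An infinite product is handled only through its congruences to finite ones; an identity holds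
once it holds modulo every `X ^ N`. -/
theorem X_pow_dvd_qPochInf_sub_qPoch (a : R⟦X⟧) {Q : R⟦X⟧} (hQ : X ∣ Q) (N : ℕ) :
    (X : R⟦X⟧) ^ N ∣ qPochInf a Q - qPoch a Q N := by
  refine X_pow_dvd_iff.2 fun n hn => ?_
  rw [map_sub, coeff_qPoch_eq_coeff_qPochInf a Q hQ hn, sub_self]

theorem qPochInf_eq_mul (a : R⟦X⟧) {Q : R⟦X⟧} (hQ : X ∣ Q) :
    qPochInf a Q = (1 - a) * qPochInf (a * Q) Q := by
  rw [← sub_eq_zero]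
  refine eq_zero_of_forall_X_pow_dvd fun N => ?_
  obtain ⟨u, hu⟩ := X_pow_dvd_qPochInf_sub_qPoch a hQ (N + 1)
  obtain ⟨v, hv⟩ := X_pow_dvd_qPochInf_sub_qPoch (a * Q) hQ N
  rw [qPoch_succ'] at hu
  exact ⟨X * u - (1 - a) * v, by linear_combination hu - (1 - a) * hv⟩

theorem qPochInf_one {Q : R⟦X⟧} (hQ : X ∣ Q) : qPochInf 1 Q = 0 := by
  rw [qPochInf_eq_mul 1 hQ, sub_self, zero_mul]

theorem qPochInf_eq_qPoch_mul (a : R⟦X⟧) {Q : R⟦X⟧} (hQ : X ∣ Q) (n : ℕ) :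
    qPochInf a Q = qPoch a Q n * qPochInf (a * Q ^ n) Q := by
  induction n with
  | zero => simp [qPoch_zero]
  | succ n ih =>
    rw [ih, qPoch_succ, qPochInf_eq_mul (a * Q ^ n) hQ, pow_succ]
    ring_nf

theorem qPoch_two_mul (a Q : R⟦X⟧) (n : ℕ) :
    qPoch a Q (2 * n) = qPoch a (Q ^ 2) n * qPoch (a * Q) (Q ^ 2) n := by
  induction n with
  | zero => simp [qPoch_zero]
  | succ n ih =>
    rw [show 2 * (n + 1) = 2 * n + 1 + 1 by ring, qPoch_succ, qPoch_succ, ih, qPoch_succ,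
      qPoch_succ]
    ring

theorem qPochInf_eq_mul_sq (a : R⟦X⟧) {Q : R⟦X⟧} (hQ : X ∣ Q) :
    qPochInf a Q = qPochInf a (Q ^ 2) * qPochInf (a * Q) (Q ^ 2) := by
  rw [← sub_eq_zero]
  refine eq_zero_of_forall_X_pow_dvd fun N => ?_
  have hQ2 : X ∣ Q ^ 2 := hQ.trans (dvd_pow_self Q two_ne_zero)
  obtain ⟨t, ht⟩ := (pow_dvd_pow X (show N ≤ 2 * N by omega)).trans
    (X_pow_dvd_qPochInf_sub_qPoch a hQ (2 * N))
  obtain ⟨u, hu⟩ := X_pow_dvd_qPochInf_sub_qPoch a hQ2 N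
  obtain ⟨v, hv⟩ := X_pow_dvd_qPochInf_sub_qPoch (a * Q) hQ2 N
  rw [qPoch_two_mul] at ht
  exact ⟨t - u * qPochInf (a * Q) (Q ^ 2) - qPoch a (Q ^ 2) N * v, by
    linear_combination ht - qPochInf (a * Q) (Q ^ 2) * hu - qPoch a (Q ^ 2) N * hv⟩

theorem dvd_qPoch_sub_one (a Q : R⟦X⟧) (n : ℕ) : a ∣ qPoch a Q n - 1 := by
  induction n with
  | zero => simp [qPoch_zero]
  | succ n ih =>
    obtain ⟨u, hu⟩ := ih
    exact ⟨u - qPoch a Q n * Q ^ n, by rw [qPoch_succ]; linear_combination hu⟩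

theorem X_pow_dvd_qPochInf_sub_one {a Q : R⟦X⟧} (hQ : X ∣ Q) {N : ℕ} (ha : X ^ N ∣ a) :
    (X : R⟦X⟧) ^ N ∣ qPochInf a Q - 1 := by
  have h := dvd_add (X_pow_dvd_qPochInf_sub_qPoch a hQ N) (ha.trans (dvd_qPoch_sub_one a Q N))
  simpa using h

theorem qPochInf_zero {Q : R⟦X⟧} (hQ : X ∣ Q) : qPochInf 0 Q = 1 :=
  sub_eq_zero.1 <| eq_zero_of_forall_X_pow_dvd fun _ =>
    X_pow_dvd_qPochInf_sub_one hQ (dvd_zero _)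

theorem psInv_eq_of_mul_eq_one {F G : R⟦X⟧} (hF : constantCoeff F = 1) (h : F * G = 1) :
    psInv F = G := by
  have h1 : F * psInv F = 1 := mul_invOfUnit F 1 (by simpa using hF)
  calc psInv F = psInv F * (F * G) := by rw [h, mul_one]
    _ = (F * psInv F) * G := by ring
    _ = G := by rw [h1, one_mul]

theorem psInv_qPochInf_mul {a Q : R⟦X⟧} (hQ : X ∣ Q) (ha : X ∣ a) :
    psInv (qPochInf (a * Q) Q) = (1 - a) * psInv (qPochInf a Q) := by
  have h1 := qPochInf_mul_psInv a Q ha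
  have h2 := qPochInf_mul_psInv (a * Q) Q (ha.mul_right Q)
  have h3 := qPochInf_eq_mul a hQ
  linear_combination (-psInv (qPochInf (a * Q) Q)) * h1 + (1 - a) * psInv (qPochInf a Q) * h2
    + psInv (qPochInf (a * Q) Q) * psInv (qPochInf a Q) * h3

theorem psInv_one : psInv (1 : R⟦X⟧) = 1 :=
  psInv_eq_of_mul_eq_one (map_one _) (one_mul 1)

theorem X_pow_dvd_psInv_qPochInf_sub_one {a Q : R⟦X⟧} (hQ : X ∣ Q) (h1 : X ∣ a) {N : ℕ}
    (ha : X ^ N ∣ a) : (X : R⟦X⟧) ^ N ∣ psInv (qPochInf a Q) - 1 := by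
  obtain ⟨u, hu⟩ := X_pow_dvd_qPochInf_sub_one hQ ha
  exact ⟨-(psInv (qPochInf a Q) * u), by
    linear_combination (-psInv (qPochInf a Q)) * hu + qPochInf_mul_psInv a Q h1⟩

/-- The partial sums of a `₃φ₂` series with one numerator parameter equal to the base. -/
noncomputable def psi (Q D E A B t : R⟦X⟧) (N : ℕ) : R⟦X⟧ :=
  ∑ n ∈ range N, Q ^ n * qPochInf (Q * Q ^ n) Q * qPochInf (t * B * Q ^ n) Q
    * qPochInf (t * A * Q ^ n) Q * psInv (qPochInf (D * Q ^ n) Q)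
    * psInv (qPochInf (E * Q ^ n) Q) * psInv (qPochInf (t * Q ^ n) Q)

/-- Contiguous relation: the combination telescopes with the terms `U n` below, from `U 0 = 0` to `U
N ≡ -1`. The balancing condition `h` makes the summands match, and it survives multiplying D, E, A,
B by Q, so the relation can be iterated. -/
theorem psi_step {Q D E A B t : R⟦X⟧} (hQ : X ∣ Q) (hD : X ∣ D) (hE : X ∣ E) (ht : X ∣ t)
    (h : D * E * Q = A * B * t) (N : ℕ) :
    (X : R⟦X⟧) ^ N ∣ (1 - D) * (1 - E) * psi Q D E A B t N
      - t * (1 - A) * (1 - B) * psi Q (D * Q) (E * Q) (A * Q) (B * Q) t N - 1 := by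
  set U : ℕ → R⟦X⟧ := fun n => (-1 + D * E * Q ^ n) * qPochInf (Q ^ n) Q
    * qPochInf (t * B * Q ^ n) Q * qPochInf (t * A * Q ^ n) Q * psInv (qPochInf (D * Q ^ n) Q)
    * psInv (qPochInf (E * Q ^ n) Q) * psInv (qPochInf (t * Q ^ n) Q) with hU
  have key : (1 - D) * (1 - E) * psi Q D E A B t N
      - t * (1 - A) * (1 - B) * psi Q (D * Q) (E * Q) (A * Q) (B * Q) t N = U 0 - U N := by
    rw [← Finset.sum_range_sub', psi, psi, Finset.mul_sum, Finset.mul_sum,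
      ← Finset.sum_sub_distrib]
    refine Finset.sum_congr rfl fun n _ => ?_
    have e1 := qPochInf_eq_mul (Q ^ n) hQ
    have e2 := qPochInf_eq_mul (t * B * Q ^ n) hQ
    have e3 := qPochInf_eq_mul (t * A * Q ^ n) hQ
    have e4 := psInv_qPochInf_mul hQ (hD.mul_right (Q ^ n))
    have e5 := psInv_qPochInf_mul hQ (hE.mul_right (Q ^ n))
    have e6 := psInv_qPochInf_mul hQ (ht.mul_right (Q ^ n))
    simp only [hU, pow_succ, ← mul_assoc]
    rw [show Q * Q ^ n = Q ^ n * Q by ring, show t * B * Q * Q ^ n = t * B * Q ^ n * Q by ring,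
      show t * A * Q * Q ^ n = t * A * Q ^ n * Q by ring,
      show D * Q * Q ^ n = D * Q ^ n * Q by ring, show E * Q * Q ^ n = E * Q ^ n * Q by ring,
      e1, e2, e3, e4, e5, e6]
    linear_combination (Q ^ n * (1 - D * Q ^ n) * (1 - E * Q ^ n) * (1 - t * Q ^ n)
      * qPochInf (Q ^ n * Q) Q * qPochInf (t * B * Q ^ n * Q) Q * qPochInf (t * A * Q ^ n * Q) Q
      * psInv (qPochInf (D * Q ^ n) Q) * psInv (qPochInf (E * Q ^ n) Q)
      * psInv (qPochInf (t * Q ^ n) Q)) * h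
  -- The factor (Q^n)_∞ becomes (1; Q)_∞ at n = 0.
  have hz : U 0 = 0 := by simp [hU, qPochInf_one hQ]
  have hQN : (X : R⟦X⟧) ^ N ∣ Q ^ N := pow_dvd_pow_of_dvd hQ N
  rw [key, hz]
  obtain ⟨x0, h0⟩ := id hQN
  obtain ⟨x1, h1⟩ := X_pow_dvd_qPochInf_sub_one hQ hQN
  obtain ⟨x2, h2⟩ := X_pow_dvd_qPochInf_sub_one hQ (hQN.mul_left (t * B))
  obtain ⟨x3, h3⟩ := X_pow_dvd_qPochInf_sub_one hQ (hQN.mul_left (t * A))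
  obtain ⟨x4, h4⟩ := X_pow_dvd_psInv_qPochInf_sub_one hQ (hD.mul_right (Q ^ N)) (hQN.mul_left D)
  obtain ⟨x5, h5⟩ := X_pow_dvd_psInv_qPochInf_sub_one hQ (hE.mul_right (Q ^ N)) (hQN.mul_left E)
  obtain ⟨x6, h6⟩ := X_pow_dvd_psInv_qPochInf_sub_one hQ (ht.mul_right (Q ^ N)) (hQN.mul_left t)
  have dvd_mul_sub_one : ∀ {a b : R⟦X⟧}, X ^ N ∣ a - 1 → X ^ N ∣ b - 1 → X ^ N ∣ a * b - 1 := by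
    rintro a b ⟨u, hu⟩ ⟨v, hv⟩
    exact ⟨u * b + v, by linear_combination b * hu + hv⟩
  have hneg : -U N - 1 = (1 - D * E * Q ^ N) * qPochInf (Q ^ N) Q
    * qPochInf (t * B * Q ^ N) Q * qPochInf (t * A * Q ^ N) Q * psInv (qPochInf (D * Q ^ N) Q)
    * psInv (qPochInf (E * Q ^ N) Q) * psInv (qPochInf (t * Q ^ N) Q) - 1 := by
    simp only [hU]; ring
  rw [zero_sub, hneg]
  refine dvd_mul_sub_one (dvd_mul_sub_one (dvd_mul_sub_one (dvd_mul_sub_one (dvd_mul_sub_one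
    (dvd_mul_sub_one ⟨-(D * E * x0), ?_⟩ ⟨x1, h1⟩) ⟨x2, h2⟩) ⟨x3, h3⟩) ⟨x4, h4⟩) ⟨x5, h5⟩) ⟨x6, h6⟩
  linear_combination (-(D * E)) * h0

/-- M applications of `psi_step`. The products `psInv (qPochInf D Q) * qPochInf (D * Q ^ l) Q` stand
for 1/(D; Q)_l, so that no division by finite products is needed. -/
theorem psi_iterate {Q D E A B t : R⟦X⟧} (hQ : X ∣ Q) (hD : X ∣ D) (hE : X ∣ E) (ht : X ∣ t)
    (h : D * E * Q = A * B * t) (N M : ℕ) :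
    (X : R⟦X⟧) ^ N ∣ psi Q D E A B t N
      - ∑ l ∈ range M, t ^ l * qPoch A Q l * qPoch B Q l
          * (psInv (qPochInf D Q) * qPochInf (D * Q ^ (l + 1)) Q)
          * (psInv (qPochInf E Q) * qPochInf (E * Q ^ (l + 1)) Q)
      - t ^ M * qPoch A Q M * qPoch B Q M
          * (psInv (qPochInf D Q) * qPochInf (D * Q ^ M) Q)
          * (psInv (qPochInf E Q) * qPochInf (E * Q ^ M) Q)
          * psi Q (D * Q ^ M) (E * Q ^ M) (A * Q ^ M) (B * Q ^ M) t N := by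
  induction M with
  | zero =>
    have h1 := qPochInf_mul_psInv D Q hD
    have h2 := qPochInf_mul_psInv E Q hE
    refine ⟨0, ?_⟩
    simp only [Finset.range_zero, Finset.sum_empty, pow_zero, mul_one, qPoch_zero]
    linear_combination (-psi Q D E A B t N) * (h2 + qPochInf E Q * psInv (qPochInf E Q) * h1)
  | succ M ih =>
    have hs := psi_step hQ (hD.mul_right (Q ^ M)) (hE.mul_right (Q ^ M)) ht
      (show D * Q ^ M * (E * Q ^ M) * Q = A * Q ^ M * (B * Q ^ M) * t by
        linear_combination Q ^ M * Q ^ M * h) N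
    obtain ⟨u, hu⟩ := ih
    obtain ⟨v, hv⟩ := hs
    have e1 := qPochInf_eq_mul (D * Q ^ M) hQ
    have e2 := qPochInf_eq_mul (E * Q ^ M) hQ
    simp only [e1, e2] at hu
    simp only [Finset.sum_range_succ, qPoch_succ, pow_succ, ← mul_assoc] at hu hv ⊢
    refine ⟨u + t ^ M * qPoch A Q M * qPoch B Q M
          * (psInv (qPochInf D Q) * qPochInf (D * Q ^ M * Q) Q)
          * (psInv (qPochInf E Q) * qPochInf (E * Q ^ M * Q) Q) * v, ?_⟩
    linear_combination hu + t ^ M * qPoch A Q M * qPoch B Q M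
          * (psInv (qPochInf D Q) * qPochInf (D * Q ^ M * Q) Q)
          * (psInv (qPochInf E Q) * qPochInf (E * Q ^ M * Q) Q) * hv

theorem psi_eq_sum {Q D E A B t : R⟦X⟧} (hQ : X ∣ Q) (hD : X ∣ D) (hE : X ∣ E) (ht : X ∣ t)
    (h : D * E * Q = A * B * t) (N : ℕ) :
    (X : R⟦X⟧) ^ N ∣ psi Q D E A B t N
      - ∑ l ∈ range N, t ^ l * qPoch A Q l * qPoch B Q l
          * (psInv (qPochInf D Q) * qPochInf (D * Q ^ (l + 1)) Q)
          * (psInv (qPochInf E Q) * qPochInf (E * Q ^ (l + 1)) Q) := by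
  obtain ⟨u, hu⟩ := psi_iterate hQ hD hE ht h N N
  obtain ⟨v, hv⟩ : X ^ N ∣ t ^ N := pow_dvd_pow_of_dvd ht N
  -- After N iterations the remainder carries t^N, which vanishes modulo `X ^ N`.
  rw [hv] at hu
  exact ⟨_, by rw [sub_eq_iff_eq_add] at hu; rw [hu, mul_assoc (X ^ N), mul_assoc (X ^ N),
    mul_assoc (X ^ N), mul_assoc (X ^ N), mul_assoc (X ^ N), ← mul_add]⟩

/-- The generating function of the second component, relative to the smallest part. -/
noncomputable def restSeries (Q α h : R⟦X⟧) (n : ℕ) : R⟦X⟧ :=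
  qPochInf (α * Q ^ n) Q * qPochInf (h * Q * Q ^ n) Q * psInv (qPochInf (α * h * Q ^ n) Q)

/-- With y = Q^{n+1}, the identity (1 - zy)(1 - wy) + (z + w - 2)y = (1 - y)² and (1 - αQ^n)(1 - hy)
- (1 - αhQ^n)(1 - y) = (1 - h)(Q - α)Q^n give `U n - U (n + 1)` as an spt term plus a multiple of a
`psi` term. Then `psi_eq_sum` with D = αh, E = wQ, A = αw, B = hQw, t = zQ produces the rank series;
these parameters are balanced because zw = 1. -/
theorem crank_sub_rank {Q α h z w : R⟦X⟧} (hQ : X ∣ Q) (hα : X ∣ α) (hzw : z * w = 1) (N : ℕ) :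
    (X : R⟦X⟧) ^ N ∣ restSeries Q α h 0 * qPochInf Q Q * psInv (qPochInf (z * Q) Q)
        * psInv (qPochInf (w * Q) Q)
      - (1 + (1 - h) * (Q - α) * ∑ l ∈ range N, (z * Q) ^ l * qPoch (α * w) Q l
          * qPoch (h * Q * w) Q l
          * (psInv (qPochInf (α * h) Q) * qPochInf (α * h * Q ^ (l + 1)) Q)
          * (psInv (qPochInf (w * Q) Q) * qPochInf (w * Q * Q ^ (l + 1)) Q))
      - ∑ n ∈ range N, (z + w - 2) * Q ^ (n + 1) * psInv (qPochInf (z * Q ^ (n + 1)) Q)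
          * psInv (qPochInf (w * Q ^ (n + 1)) Q) * qPochInf (Q ^ (n + 2)) Q
          * restSeries Q α h (n + 1) := by
  set U : ℕ → R⟦X⟧ := fun n => restSeries Q α h n * qPochInf (Q * Q ^ n) Q
    * psInv (qPochInf (z * Q * Q ^ n) Q) * psInv (qPochInf (w * Q * Q ^ n) Q) with hU
  have hzQ : X ∣ z * Q := hQ.mul_left z
  have hwQ : X ∣ w * Q := hQ.mul_left w
  have hD : X ∣ α * h := hα.mul_right h
  obtain ⟨u, hu⟩ := psi_eq_sum hQ hD hwQ hzQ
    (show α * h * (w * Q) * Q = α * w * (h * Q * w) * (z * Q) by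
      linear_combination (-(α * h * w * Q ^ 2)) * hzw) N
  have key : (1 - h) * (Q - α) * psi Q (α * h) (w * Q) (α * w) (h * Q * w) (z * Q) N
      + ∑ n ∈ range N, (z + w - 2) * Q ^ (n + 1) * psInv (qPochInf (z * Q ^ (n + 1)) Q)
          * psInv (qPochInf (w * Q ^ (n + 1)) Q) * qPochInf (Q ^ (n + 2)) Q
          * restSeries Q α h (n + 1) = U 0 - U N := by
    rw [← Finset.sum_range_sub', psi, Finset.mul_sum, ← Finset.sum_add_distrib]
    refine Finset.sum_congr rfl fun n _ => ?_
    have e1 := qPochInf_eq_mul (Q * Q ^ n) hQ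
    have e2 := qPochInf_eq_mul (α * Q ^ n) hQ
    have e3 := qPochInf_eq_mul (h * Q * Q ^ n) hQ
    have e4 := psInv_qPochInf_mul hQ (hD.mul_right (Q ^ n))
    have e5 := psInv_qPochInf_mul hQ (hwQ.mul_right (Q ^ n))
    have e6 := psInv_qPochInf_mul hQ (hzQ.mul_right (Q ^ n))
    simp only [hU, restSeries]
    rw [show z * Q * (h * Q * w) * Q ^ n = h * Q * Q ^ n * Q by
        linear_combination (h * Q ^ 2 * Q ^ n) * hzw,
      show z * Q * (α * w) * Q ^ n = α * Q ^ n * Q by linear_combination (α * Q * Q ^ n) * hzw,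
      show z * Q ^ (n + 1) = z * Q * Q ^ n by ring, show w * Q ^ (n + 1) = w * Q * Q ^ n by ring,
      show Q ^ (n + 2) = Q * Q ^ n * Q by ring, show Q * Q ^ (n + 1) = Q * Q ^ n * Q by ring,
      show α * Q ^ (n + 1) = α * Q ^ n * Q by ring,
      show h * Q * Q ^ (n + 1) = h * Q * Q ^ n * Q by ring,
      show α * h * Q ^ (n + 1) = α * h * Q ^ n * Q by ring,
      show w * Q * Q ^ (n + 1) = w * Q * Q ^ n * Q by ring,
      show z * Q * Q ^ (n + 1) = z * Q * Q ^ n * Q by ring, e4, e5, e6, e1, e2, e3]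
    rw [pow_succ]
    linear_combination (Q ^ 2 * Q ^ (n * 2) * (1 - α * h * Q ^ n) * qPochInf (Q * Q ^ n * Q) Q
      * qPochInf (h * Q * Q ^ n * Q) Q * qPochInf (α * Q ^ n * Q) Q
      * psInv (qPochInf (α * h * Q ^ n) Q) * psInv (qPochInf (w * Q * Q ^ n) Q)
      * psInv (qPochInf (z * Q * Q ^ n) Q)) * hzw
  have hU0 : U 0 = restSeries Q α h 0 * qPochInf Q Q * psInv (qPochInf (z * Q) Q)
        * psInv (qPochInf (w * Q) Q) := by simp [hU]
  have hQN : (X : R⟦X⟧) ^ N ∣ Q ^ N := pow_dvd_pow_of_dvd hQ N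
  have hUN : X ^ N ∣ U N - 1 := by
    have dvd_mul_sub_one : ∀ {a b : R⟦X⟧}, X ^ N ∣ a - 1 → X ^ N ∣ b - 1 → X ^ N ∣ a * b - 1 := by
      rintro a b ⟨u, hu⟩ ⟨v, hv⟩
      exact ⟨u * b + v, by linear_combination b * hu + hv⟩
    have hp : ∀ a, X ^ N ∣ qPochInf (a * Q ^ N) Q - 1 := fun a =>
      X_pow_dvd_qPochInf_sub_one hQ (hQN.mul_left a)
    have hi : ∀ a, X ∣ a → X ^ N ∣ psInv (qPochInf (a * Q ^ N) Q) - 1 := fun a ha =>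
      X_pow_dvd_psInv_qPochInf_sub_one hQ (ha.mul_right _) (hQN.mul_left a)
    exact dvd_mul_sub_one (dvd_mul_sub_one (dvd_mul_sub_one (dvd_mul_sub_one (dvd_mul_sub_one
      (hp _) (hp _)) (hi _ hD)) (hp _)) (hi _ hzQ)) (hi _ hwQ)
  obtain ⟨v, hv⟩ := hUN
  rw [← hU0]
  exact ⟨v + (1 - h) * (Q - α) * u, by linear_combination (-1 : R⟦X⟧) * key + hv
    + (1 - h) * (Q - α) * hu⟩

end QSeries

/-! ### Symmetrized moments as coefficient extraction in z - 2 + z⁻¹. -/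

section Moments

open LaurentPolynomial

/-- The functional `∑ a_m z^m ↦ ∑ binom(m + c, d) a_m` on Laurent polynomials. -/
noncomputable def shiftMoment (c : ℤ) (d : ℕ) : ℤ[T;T⁻¹] →+ ℤ :=
  (Finsupp.liftAddHom fun m : ℤ => AddMonoidHom.mulLeft (Ring.choose (m + c) d)).comp
    AddMonoidAlgebra.coeffAddEquiv.toAddMonoidHom

theorem shiftMoment_apply (c : ℤ) (d : ℕ) (p : ℤ[T;T⁻¹]) :
    shiftMoment c d p = p.coeff.sum fun m a => Ring.choose (m + c) d * a := rfl

theorem shiftMoment_C_mul_T (c : ℤ) (d : ℕ) (a m : ℤ) :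
    shiftMoment c d (C a * T m) = Ring.choose (m + c) d * a := by
  rw [← single_eq_C_mul_T, shiftMoment_apply, AddMonoidAlgebra.coeff_single,
    Finsupp.sum_single_index (by simp)]

/-- The Laurent polynomial `z - 2 + z⁻¹`. -/
noncomputable def yy : ℤ[T;T⁻¹] := T 1 + T (-1) - 2

theorem yy_mul_C_mul_T (a m : ℤ) :
    yy * (C a * T m) = C a * T (m + 1) + C a * T (m - 1) - (C a * T m + C a * T m) := by
  rw [yy, T_add, T_sub]
  ring

/-- Second central difference: by Pascal's rule, binom(x+1, d+2) - 2 binom(x, d+2) + binom(x-1, d+2)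
= binom(x-1, d). -/
theorem shiftMoment_yy_mul (c : ℤ) (d : ℕ) (p : ℤ[T;T⁻¹]) :
    shiftMoment c (d + 2) (yy * p) = shiftMoment (c - 1) d p := by
  induction p using LaurentPolynomial.induction_on' with
  | add p q hp hq => rw [mul_add, map_add, map_add, hp, hq]
  | C_mul_T m a =>
    rw [yy_mul_C_mul_T, map_sub, map_add, map_add]
    simp only [shiftMoment_C_mul_T]
    have h1 := Ring.choose_succ_succ (m + c) (d + 1)
    have h2 := Ring.choose_succ_succ (m + c - 1) (d + 1)
    have h3 := Ring.choose_succ_succ (m + c - 1) d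
    rw [show m + c + 1 = m + 1 + c by ring] at h1
    rw [sub_add_cancel] at h2 h3
    rw [show m - 1 + c = m + c - 1 by ring, show m + (c - 1) = m + c - 1 by ring]
    linear_combination a * (h1 - h2 + h3)

theorem shiftMoment_zero_yy_mul (c : ℤ) (p : ℤ[T;T⁻¹]) : shiftMoment c 0 (yy * p) = 0 := by
  induction p using LaurentPolynomial.induction_on' with
  | add p q hp hq => rw [mul_add, map_add, hp, hq, add_zero]
  | C_mul_T m a =>
    rw [yy_mul_C_mul_T, map_sub, map_add, map_add]
    simp only [shiftMoment_C_mul_T, Ring.choose_zero_right]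
    ring

/-- Each factor `yy` lowers (k-1, 2k) to the same pair for k-1. If the factors run out first,
binom(k'-1, 2k') = 0 is left for some k' ≥ 1; if the order reaches 0 first, a further factor `yy`
gives 0, as its coefficients sum to 0. -/
theorem shiftMoment_yy_pow (k j : ℕ) :
    shiftMoment ((k : ℤ) - 1) (2 * k) (yy ^ j) = if j = k then 1 else 0 := by
  induction k generalizing j with
  | zero =>
    cases j with
    | zero =>
      rw [pow_zero, ← T_zero, ← one_mul (T 0), ← map_one C, shiftMoment_C_mul_T]
      simp
    | succ j => rw [pow_succ', shiftMoment_zero_yy_mul]; simp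
  | succ k ih =>
    cases j with
    | zero =>
      rw [pow_zero, ← T_zero, ← one_mul (T 0), ← map_one C, shiftMoment_C_mul_T,
        show (0 : ℤ) + (((k + 1 : ℕ) : ℤ) - 1) = (k : ℕ) by push_cast; ring,
        Ring.choose_natCast, Nat.choose_eq_zero_of_lt (by omega)]
      simp
    | succ j =>
      rw [pow_succ', show 2 * (k + 1) = 2 * k + 2 by ring, shiftMoment_yy_mul,
        show ((k + 1 : ℕ) : ℤ) - 1 - 1 = (k : ℤ) - 1 by push_cast; ring, ih]
      simp

theorem shiftMoment_aeval_yy (k : ℕ) (p : Polynomial ℤ) :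
    shiftMoment ((k : ℤ) - 1) (2 * k) (Polynomial.aeval yy p) = p.coeff k := by
  induction p using Polynomial.induction_on' with
  | add p q hp hq => rw [map_add, map_add, hp, hq, Polynomial.coeff_add]
  | monomial n a =>
    rw [Polynomial.aeval_monomial, Polynomial.coeff_monomial, ← Algebra.smul_def, map_zsmul,
      shiftMoment_yy_pow]
    simp

theorem symMoment_coeff (k : ℕ) (p : ℤ[T;T⁻¹]) :
    symMoment (2 * k) (fun m => p.coeff m) = shiftMoment ((k : ℤ) - 1) (2 * k) p := by
  rw [symMoment, shiftMoment_apply, Finsupp.sum,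
    show (((2 * k : ℕ) : ℤ) - 1) / 2 = (k : ℤ) - 1 by push_cast; omega]
  refine finsum_eq_sum_of_support_subset _ fun m hm => ?_
  rw [Finset.mem_coe, Finsupp.mem_support_iff]
  exact right_ne_zero_of_mul hm

theorem symMoment_card {α : Type*} (k : ℕ) (s : Finset α) (r : α → ℤ) :
    symMoment (2 * k) (fun m => ((s.filter fun x => r x = m).card : ℤ))
      = shiftMoment ((k : ℤ) - 1) (2 * k) (∑ x ∈ s, T (r x)) := by
  rw [← symMoment_coeff]
  congr 1
  ext m
  rw [AddMonoidAlgebra.coeff_sum, Finsupp.finsetSum_apply]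
  simp

end Moments

/-! ### Generating functions of weighted partitions and of layered sums. -/

section PartitionSeries

open PowerSeries Finset

variable {R : Type*} [CommRing R]

/-- The series `∑_f g(f) X^(i f)`. -/
noncomputable def partSeries (i : ℕ) (g : ℕ → R) : R⟦X⟧ :=
  PowerSeries.mk fun m => if i ∣ m then g (m / i) else 0

theorem coeff_partSeries (i : ℕ) (g : ℕ → R) (m : ℕ) :
    coeff m (partSeries i g) = if i ∣ m then g (m / i) else 0 := coeff_mk _ _

theorem partSeries_add (i : ℕ) (g g' : ℕ → R) :
    partSeries i (fun f => g f + g' f) = partSeries i g + partSeries i g' := by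
  ext m
  simp only [map_add, coeff_partSeries]
  split_ifs <;> simp

theorem partSeries_const_mul (i : ℕ) (c : R) (g : ℕ → R) :
    partSeries i (fun f => c * g f) = C c * partSeries i g := by
  ext m
  simp only [coeff_C_mul, coeff_partSeries]
  split_ifs <;> simp

theorem partSeries_single {i : ℕ} (hi : 0 < i) (j : ℕ) (c : R) :
    partSeries i (fun f => if f = j then c else 0) = C c * X ^ (i * j) := by
  ext m
  rw [coeff_partSeries, coeff_C_mul, coeff_X_pow]
  by_cases h : i ∣ m
  · obtain ⟨f, rfl⟩ := h
    simp [Nat.mul_div_cancel_left f hi, hi.ne']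
  · have : m ≠ i * j := fun h' => h ⟨j, h'⟩
    simp [h, this]

theorem X_pow_mul_partSeries {i : ℕ} (hi : 0 < i) (g : ℕ → R) :
    X ^ i * partSeries i g = partSeries i fun f => if f = 0 then 0 else g (f - 1) := by
  ext m
  rw [coeff_X_pow_mul', coeff_partSeries, coeff_partSeries]
  by_cases h : i ∣ m
  · obtain ⟨f, rfl⟩ := h
    cases f with
    | zero => simp [hi.ne']
    | succ f =>
      have : i * (f + 1) - i = i * f := by rw [Nat.mul_succ, Nat.add_sub_cancel]
      simp [Nat.mul_div_cancel_left _ hi, this, Nat.le_mul_of_pos_right]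
  · have : ∀ (_ : i ≤ m), ¬ i ∣ m - i := fun hle h' => h ((Nat.dvd_sub_iff_left hle (dvd_refl i)).1 h')
    simp only [h, if_false]
    split_ifs with h1 h2
    · exact absurd h2 (this h1)
    · rfl
    · rfl

theorem partSeries_geom {i : ℕ} (hi : 0 < i) (c : R) :
    (1 - C c * X ^ i) * partSeries i (fun f => c ^ f) = 1 := by
  have h := partSeries_const_mul i c (fun f => if f = 0 then 0 else c ^ (f - 1))
  rw [← X_pow_mul_partSeries hi (fun f => c ^ f)] at h
  have h1 := partSeries_single hi 0 (1 : R)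
  have h2 := partSeries_add i (fun f => if f = 0 then (1 : R) else 0)
    (fun f => c * if f = 0 then 0 else c ^ (f - 1))
  have h3 : (fun f => (if f = 0 then (1 : R) else 0) + c * if f = 0 then 0 else c ^ (f - 1))
      = fun f => c ^ f := by
    funext f
    cases f with
    | zero => simp
    | succ f => simp [pow_succ']
  rw [h3, h, h1] at h2
  simp only [map_one, mul_zero, pow_zero, mul_one] at h2
  linear_combination h2

theorem partSeries_distinct {i : ℕ} (hi : 0 < i) (c : R) :
    partSeries i (fun f => if f = 0 then 1 else if f = 1 then c else 0) = 1 + C c * X ^ i := by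
  have h := partSeries_add i (fun f => if f = 0 then (1 : R) else 0) (fun f => if f = 1 then c else 0)
  rw [partSeries_single hi, partSeries_single hi] at h
  simp only [map_one, mul_zero, pow_zero, mul_one] at h
  rw [← h]
  congr 1
  funext f
  split_ifs <;> simp_all

/-- The series of a linear recurrence with characteristic polynomial x² - cx + 1; for c = z + z⁻¹
the denominator factors as in the crank. -/
theorem partSeries_recurrence {i : ℕ} (hi : 0 < i) (c : R) (g : ℕ → R)
    (hg : ∀ f, g (f + 2) = c * g (f + 1) - g f) :
    (1 - C c * X ^ i + X ^ i * X ^ i) * partSeries i g = C (g 0) + C (g 1 - c * g 0) * X ^ i := by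
  have h1 := X_pow_mul_partSeries hi g
  have h2 := X_pow_mul_partSeries hi (fun f => if f = 0 then 0 else g (f - 1))
  rw [← h1] at h2
  have h3 := partSeries_const_mul i (-c) (fun f => if f = 0 then 0 else g (f - 1))
  rw [← h1] at h3
  have h4 := partSeries_single hi 0 (g 0)
  have h5 := partSeries_single hi 1 (g 1 - c * g 0)
  have key : partSeries i g + C (-c) * (X ^ i * partSeries i g) + X ^ i * (X ^ i * partSeries i g)
      = C (g 0) * X ^ (i * 0) + C (g 1 - c * g 0) * X ^ (i * 1) := by
    rw [← h3, h2, ← h4, ← h5, ← partSeries_add, ← partSeries_add, ← partSeries_add]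
    congr 1
    funext f
    match f with
    | 0 => simp
    | 1 => simp; ring
    | f + 2 => simp [hg f]; ring
  rw [map_neg, mul_zero, pow_zero, mul_one, mul_one] at key
  linear_combination key

/-- The generating function of the partitions weighted by `w`. -/
noncomputable def gf (w : Multiset ℕ → R) : R⟦X⟧ :=
  PowerSeries.mk fun n => ∑ s ∈ partitionsOf n, w s

theorem coeff_gf (w : Multiset ℕ → R) (n : ℕ) : coeff n (gf w) = ∑ s ∈ partitionsOf n, w s :=
  coeff_mk _ _

/-- The weight `∏ g(i, f_i)` of the partitions with parts in `P`, and `0` on the others. -/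
def partsWeight (P : Finset ℕ) (g : ℕ → ℕ → R) (s : Multiset ℕ) : R :=
  if ∀ i ∈ s, i ∈ P then ∏ i ∈ P, g i (s.count i) else 0

/-- Euler product: a partition with parts in P corresponds to the exponents i · f_i taken from the
factors, and exponents not divisible by i contribute nothing. -/
theorem gf_partsWeight (P : Finset ℕ) (hP : ∀ i ∈ P, 0 < i) (g : ℕ → ℕ → R) :
    gf (partsWeight P g) = ∏ i ∈ P, partSeries i (g i) := by
  ext n
  rw [coeff_gf, coeff_prod]
  simp only [coeff_partSeries, partsWeight]
  rw [← Finset.sum_filter, ← Finset.sum_filter_add_sum_filter_not (P.finsuppAntidiag n)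
    (fun l => ∀ i ∈ P, i ∣ l i)]
  have hzero : ∑ l ∈ (P.finsuppAntidiag n).filter (fun l => ¬ ∀ i ∈ P, i ∣ l i),
      ∏ i ∈ P, (if i ∣ l i then g i (l i / i) else 0) = 0 := by
    refine Finset.sum_eq_zero fun l hl => ?_
    have := (Finset.mem_filter.1 hl).2
    push Not at this
    obtain ⟨i, hi, h⟩ := this
    exact Finset.prod_eq_zero hi (if_neg h)
  rw [hzero, add_zero]
  have hcount : ∀ (l : ℕ →₀ ℕ) (i : ℕ), i ∈ P →
      (∑ j ∈ P, Multiset.replicate (l j / j) j).count i = l i / i := by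
    intro l i hi
    rw [Multiset.count_sum', Finset.sum_eq_single i]
    · simp
    · intro b _ hb
      simp [Multiset.count_replicate, hb]
    · exact fun h => absurd hi h
  have hsum : ∀ s : Multiset ℕ, (∀ i ∈ s, i ∈ P) → ∑ i ∈ P, s.count i * i = s.sum := by
    intro s hs
    rw [Finset.sum_multiset_count]
    simp only [smul_eq_mul]
    refine (Finset.sum_subset (fun i hi => hs i (Multiset.mem_toFinset.1 hi)) fun i _ hi => ?_).symm
    rw [Multiset.mem_toFinset] at hi
    simp [hi]
  refine Finset.sum_bij'
    (fun s _ => (Finsupp.indicator P fun i _ => s.count i * i : ℕ →₀ ℕ))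
    (fun l _ => ∑ j ∈ P, Multiset.replicate (l j / j) j) ?_ ?_ ?_ ?_ ?_
  · intro s hs
    rw [Finset.mem_filter, mem_partitionsOf] at hs
    rw [Finset.mem_filter, Finset.mem_finsuppAntidiag]
    refine ⟨⟨?_, Finsupp.support_indicator_subset _ _⟩, fun i hi => ?_⟩
    · rw [← hs.1.2, ← hsum s hs.2]
      exact Finset.sum_congr rfl fun i hi => by simp [Finsupp.indicator_apply, hi]
    · simp [Finsupp.indicator_apply, hi]
  · intro l hl
    rw [Finset.mem_filter, Finset.mem_finsuppAntidiag] at hl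
    have hmem : ∀ i ∈ ∑ j ∈ P, Multiset.replicate (l j / j) j, i ∈ P := by
      intro i hi
      rw [Multiset.mem_sum] at hi
      obtain ⟨j, hj, hi⟩ := hi
      rwa [Multiset.eq_of_mem_replicate hi]
    rw [Finset.mem_filter, mem_partitionsOf]
    refine ⟨⟨fun i hi => hP i (hmem i hi), ?_⟩, hmem⟩
    rw [← hsum _ hmem, ← hl.1.1]
    exact Finset.sum_congr rfl fun i hi => by rw [hcount l i hi, Nat.div_mul_cancel (hl.2 i hi)]
  · intro s hs
    rw [Finset.mem_filter, mem_partitionsOf] at hs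
    ext i
    by_cases hi : i ∈ P
    · rw [hcount _ i hi, Finsupp.indicator_apply, dif_pos hi, Nat.mul_div_cancel _ (hP i hi)]
    · rw [Multiset.count_eq_zero_of_notMem fun h => hi (hs.2 i h), Multiset.count_eq_zero]
      intro h
      rw [Multiset.mem_sum] at h
      obtain ⟨j, hj, h⟩ := h
      exact hi (Multiset.eq_of_mem_replicate h ▸ hj)
  · intro l hl
    rw [Finset.mem_filter, Finset.mem_finsuppAntidiag] at hl
    ext i
    rw [Finsupp.indicator_apply]
    split_ifs with hi
    · rw [hcount l i hi, Nat.div_mul_cancel (hl.2 i hi)]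
    · by_contra h
      exact hi (hl.1.2 (Finsupp.mem_support_iff.2 (Ne.symm h)))
  · intro s hs
    refine Finset.prod_congr rfl fun i hi => ?_
    simp [Finsupp.indicator_apply, hi, Nat.mul_div_cancel _ (hP i hi)]

theorem sum_partitionPairs (w₁ w₂ : Multiset ℕ → R) (n : ℕ) :
    ∑ π ∈ partitionPairs n, w₁ π.1 * w₂ π.2 = coeff n (gf w₁ * gf w₂) := by
  rw [partitionPairs, Finset.sum_biUnion, coeff_mul]
  · refine Finset.sum_congr rfl fun x _ => ?_
    rw [coeff_gf, coeff_gf, Finset.sum_product, Finset.sum_mul_sum]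
  · intro x _ y _ hxy
    refine Finset.disjoint_left.2 fun π hx hy => hxy ?_
    rw [Finset.mem_product, mem_partitionsOf, mem_partitionsOf] at hx hy
    exact Prod.ext (hx.1.2.symm.trans hy.1.2) (hx.2.2.symm.trans hy.2.2)

theorem sum_partitionTriples (w₁ w₂ w₃ : Multiset ℕ → R) (n : ℕ) :
    ∑ π ∈ partitionTriples n, w₁ π.1 * (w₂ π.2.1 * w₃ π.2.2)
      = coeff n (gf w₁ * (gf w₂ * gf w₃)) := by
  rw [partitionTriples, Finset.sum_biUnion, coeff_mul]
  · refine Finset.sum_congr rfl fun x _ => ?_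
    rw [coeff_gf, ← sum_partitionPairs, Finset.sum_product, Finset.sum_mul_sum]
  · intro x _ y _ hxy
    refine Finset.disjoint_left.2 fun π hx hy => hxy ?_
    rw [Finset.mem_product, mem_partitionsOf, mem_partitionPairs] at hx hy
    exact Prod.ext (hx.1.2.symm.trans hy.1.2) (hx.2.2.2.symm.trans hy.2.2.2)

/-- Serves for the ranks: the objects with bounded largest part have product generating functions,
and those with a prescribed largest part are differences of these. -/
theorem sum_layers {α : Type*} (S : Finset α) (c : α → ℕ) (t : ℕ → R) (v : α → R) (N : ℕ)
    (hc : ∀ x ∈ S, c x ≤ N) :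
    ∑ x ∈ S, t (c x) * v x = t 0 * ∑ x ∈ S with c x ≤ 0, v x
      + ∑ l ∈ range N, t (l + 1) * (∑ x ∈ S with c x ≤ l + 1, v x - ∑ x ∈ S with c x ≤ l, v x) := by
  classical
  rw [← Finset.sum_fiberwise_of_maps_to (t := range (N + 1)) (g := c)
    (fun x hx => Finset.mem_range.2 (Nat.lt_succ_of_le (hc x hx))), Finset.sum_range_succ', add_comm]
  congr 1
  · rw [Finset.mul_sum]
    refine Finset.sum_congr (by simp) fun x hx => ?_
    rw [Nat.le_zero.1 (Finset.mem_filter.1 hx).2]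
  · refine Finset.sum_congr rfl fun l _ => ?_
    have h : (S.filter fun x => c x ≤ l + 1)
        = (S.filter fun x => c x ≤ l) ∪ S.filter fun x => c x = l + 1 := by
      ext x
      simp only [Finset.mem_filter, Finset.mem_union, ← and_or_left]
      exact and_congr_right fun _ => Nat.le_succ_iff
    rw [h, Finset.sum_union, add_sub_cancel_left, Finset.mul_sum]
    · exact Finset.sum_congr rfl fun x hx => by rw [(Finset.mem_filter.1 hx).2]
    · refine Finset.disjoint_left.2 fun x hx hx' => ?_
      have h1 := (Finset.mem_filter.1 hx).2
      have h2 := (Finset.mem_filter.1 hx').2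
      omega

end PartitionSeries

/-! ### The weight ω_k as a coefficient of a product of polynomials. -/

section Weights

open Finset

/-- The factors have no constant term, so the exponents chosen from them are positive and form the
blocks of a composition of k. -/
theorem coeff_prod_eq_sum_composition {A : Type*} [CommRing A] (k r : ℕ)
    (a : Fin (r + 1) → ℕ → A) :
    PowerSeries.coeff k (∏ t, PowerSeries.mk fun m => if m = 0 then 0 else a t m)
      = ∑ c : Composition k with c.length = r + 1, ∏ t, a t (c.blocks.getD t 0) := by
  rw [PowerSeries.coeff_prod]
  simp only [PowerSeries.coeff_mk]
  rw [← Finset.sum_filter_add_sum_filter_not (univ.finsuppAntidiag k)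
    (fun l : Fin (r + 1) →₀ ℕ => ∀ t, 0 < l t)]
  have hzero : ∑ l ∈ (univ.finsuppAntidiag k).filter (fun l : Fin (r + 1) →₀ ℕ => ¬ ∀ t, 0 < l t),
      ∏ t, (if l t = 0 then 0 else a t (l t)) = 0 := by
    refine Finset.sum_eq_zero fun l hl => ?_
    have := (Finset.mem_filter.1 hl).2
    push Not at this
    obtain ⟨t, ht⟩ := this
    exact Finset.prod_eq_zero (mem_univ t) (if_pos (Nat.le_zero.1 ht))
  rw [hzero, add_zero]
  symm
  have hget : ∀ (c : Composition k), c.length = r + 1 → ∀ t : Fin (r + 1),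
      ∃ h : (t : ℕ) < c.blocks.length, c.blocks.getD t 0 = c.blocks[(t : ℕ)] := by
    intro c hc t
    have h : (t : ℕ) < c.blocks.length := by rw [c.blocks_length, hc]; exact t.2
    exact ⟨h, List.getD_eq_getElem _ _ h⟩
  have hofFn : ∀ (c : Composition k), c.length = r + 1 →
      List.ofFn (fun t : Fin (r + 1) => c.blocks.getD t 0) = c.blocks := by
    intro c hc
    refine List.ext_getElem (by simp [hc]) fun i h1 h2 => ?_
    rw [List.getElem_ofFn, List.getD_eq_getElem _ _ h2]
  refine Finset.sum_bij'
    (fun c _ => Finsupp.equivFunOnFinite.symm fun t : Fin (r + 1) => c.blocks.getD t 0)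
    (fun l hl => ⟨List.ofFn l, fun {i} hi => ?_, ?_⟩) ?_ ?_ ?_ ?_ ?_
  · rw [List.mem_ofFn] at hi
    obtain ⟨t, rfl⟩ := hi
    exact (Finset.mem_filter.1 hl).2 t
  · rw [List.sum_ofFn]
    exact (Finset.mem_finsuppAntidiag.1 (Finset.mem_filter.1 hl).1).1
  · intro c hc
    have hc' := (Finset.mem_filter.1 hc).2
    rw [Finset.mem_filter, Finset.mem_finsuppAntidiag]
    refine ⟨⟨?_, Finset.subset_univ _⟩, fun t => ?_⟩
    · calc _ = ∑ t : Fin (r + 1), c.blocks.getD t 0 := rfl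
        _ = (List.ofFn fun t : Fin (r + 1) => c.blocks.getD t 0).sum := (List.sum_ofFn).symm
        _ = k := by rw [hofFn c hc', c.blocks_sum]
    · obtain ⟨h, h'⟩ := hget c hc' t
      rw [Finsupp.equivFunOnFinite_symm_apply_apply, h']
      exact c.blocks_pos (List.getElem_mem h)
  · intro l hl
    rw [Finset.mem_filter]
    exact ⟨mem_univ _, by rw [← Composition.blocks_length]; simp⟩
  · intro c hc
    apply Composition.ext
    exact hofFn c (Finset.mem_filter.1 hc).2
  · intro l hl
    ext t
    rw [Finsupp.equivFunOnFinite_symm_apply_apply,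
      List.getD_eq_getElem _ _ (by rw [List.length_ofFn]; exact t.2), List.getElem_ofFn]
  · intro c hc
    refine Finset.prod_congr rfl fun t _ => ?_
    obtain ⟨h, h'⟩ := hget c (Finset.mem_filter.1 hc).2 t
    rw [Finsupp.equivFunOnFinite_symm_apply_apply, h', if_neg]
    exact (c.blocks_pos (List.getElem_mem h)).ne'

theorem sum_powersetCard_eq_sum_strictMono {A : Type*} [CommRing A] (J : Finset ℕ) (r : ℕ)
    (u : ℕ → A) :
    ∑ S ∈ J.powersetCard r, ∏ j ∈ S, u j
      = ∑ j ∈ (Fintype.piFinset fun _ : Fin r => J).filter (fun j => StrictMono j),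
          ∏ t, u (j t) := by
  symm
  refine Finset.sum_bij' (fun j _ => univ.image j)
    (fun S hS => S.orderEmbOfFin (Finset.mem_powersetCard.1 hS).2) ?_ ?_ ?_ ?_ ?_
  · intro j hj
    rw [Finset.mem_filter, Fintype.mem_piFinset] at hj
    rw [Finset.mem_powersetCard]
    refine ⟨fun x hx => ?_, ?_⟩
    · obtain ⟨t, _, rfl⟩ := Finset.mem_image.1 hx
      exact hj.1 t
    · rw [Finset.card_image_of_injective _ hj.2.injective, Finset.card_univ, Fintype.card_fin]
  · intro S hS
    rw [Finset.mem_filter, Fintype.mem_piFinset]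
    exact ⟨fun t => (Finset.mem_powersetCard.1 hS).1 (Finset.orderEmbOfFin_mem _ _ _),
      (S.orderEmbOfFin _).strictMono⟩
  · intro j hj
    rw [Finset.mem_filter] at hj
    exact (Finset.orderEmbOfFin_unique _ (fun t => Finset.mem_image_of_mem _ (mem_univ t)) hj.2).symm
  · intro S hS
    rw [← Finset.coe_inj]
    simp
  · intro j hj
    rw [Finset.mem_filter] at hj
    rw [Finset.prod_image hj.2.injective.injOn]

/-- Expanding the product over J chooses the set of indices j_2 < ... < j_r at which a nonconstant
term is taken; the exponents, together with the one from the first factor, form the composition. -/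
theorem sum_composition_eq_coeff {A : Type*} [CommRing A] (J : Finset ℕ) (a : ℕ → A)
    (b : ℕ → ℕ → A) {k : ℕ} (hk : 1 ≤ k) :
    ∑ c : Composition k, a (entry c 1) *
        ∑ j ∈ (Fintype.piFinset fun _ : Fin (c.length - 1) => J).filter (fun j => StrictMono j),
          ∏ t : Fin (c.length - 1), b (j t) (entry c (t + 2))
      = PowerSeries.coeff k ((PowerSeries.mk fun m => if m = 0 then 0 else a m)
          * ∏ j ∈ J, (1 + PowerSeries.mk fun m => if m = 0 then 0 else b j m)) := by
  have hr : ∀ r : ℕ, PowerSeries.coeff k ((PowerSeries.mk fun m => if m = 0 then 0 else a m)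
        * ∑ S ∈ J.powersetCard r, ∏ j ∈ S, PowerSeries.mk fun m => if m = 0 then 0 else b j m)
      = ∑ c : Composition k with c.length - 1 = r, a (entry c 1) *
        ∑ j ∈ (Fintype.piFinset fun _ : Fin (c.length - 1) => J).filter (fun j => StrictMono j),
          ∏ t : Fin (c.length - 1), b (j t) (entry c (t + 2)) := by
    intro r
    have hinner : ∀ c : Composition k, c.length = r + 1 → a (entry c 1) *
        ∑ j ∈ (Fintype.piFinset fun _ : Fin (c.length - 1) => J).filter (fun j => StrictMono j),
          ∏ t : Fin (c.length - 1), b (j t) (entry c (t + 2))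
        = ∑ j ∈ (Fintype.piFinset fun _ : Fin r => J).filter (fun j => StrictMono j),
          a (c.blocks.getD 0 0) * ∏ t : Fin r, b (j t) (c.blocks.getD (t + 1) 0) := by
      intro c hc
      obtain rfl : c.length - 1 = r := by omega
      rw [Finset.mul_sum]
      rfl
    have hfilter : (univ.filter fun c : Composition k => c.length - 1 = r)
        = univ.filter fun c : Composition k => c.length = r + 1 := by
      ext c
      -- A composition of k ≥ 1 has a first block, so the subtraction in `c.length - 1` does not
      -- truncate.
      have := Composition.length_pos_iff (c := c) |>.2 hk
      simp only [Finset.mem_filter, mem_univ, true_and]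
      omega
    rw [hfilter, Finset.sum_congr rfl fun c hc => hinner c (Finset.mem_filter.1 hc).2,
      Finset.sum_comm, sum_powersetCard_eq_sum_strictMono, Finset.mul_sum, map_sum]
    refine Finset.sum_congr rfl fun j _ => ?_
    have h := coeff_prod_eq_sum_composition k r (Fin.cons a fun t => b (j t))
    simpa only [Fin.prod_univ_succ, Fin.cons_zero, Fin.cons_succ, Fin.val_zero, Fin.val_succ] using h
  rw [Finset.prod_one_add, Finset.sum_powerset,
    -- The range of r is enlarged by k, adding only empty families of subsets, so that it contains
    -- `c.length - 1` for every composition of k.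
    Finset.sum_subset (Finset.range_mono (Nat.le_add_left (J.card + 1) k)), Finset.mul_sum, map_sum,
    Finset.sum_congr rfl fun r _ => hr r]
  · refine (Finset.sum_fiberwise_of_maps_to (fun c _ => Finset.mem_range.2 ?_) _).symm
    have := c.length_le
    omega
  · intro r _ h2
    rw [Finset.powersetCard_eq_empty.2 (by simpa using h2), Finset.sum_empty]

/-- The polynomial `∑_m binom(f + m, 2m) Y^m`. -/
noncomputable def bPoly (f : ℕ) : Polynomial ℤ :=
  ∑ m ∈ range (f + 1), Polynomial.monomial m ((f + m).choose (2 * m) : ℤ)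

/-- The polynomial `∑_{m ≥ 1} binom(f + m - 1, 2m - 1) Y^m`. -/
noncomputable def bPoly₁ (f : ℕ) : Polynomial ℤ :=
  ∑ m ∈ range f, Polynomial.monomial (m + 1) ((f + m).choose (2 * m + 1) : ℤ)

theorem coeff_bPoly (f m : ℕ) : (bPoly f).coeff m = (f + m).choose (2 * m) := by
  rw [bPoly, Polynomial.finsetSum_coeff]
  simp only [Polynomial.coeff_monomial, Finset.sum_ite_eq', Finset.mem_range]
  split_ifs with h
  · rfl
  · rw [Nat.choose_eq_zero_of_lt (by omega), Nat.cast_zero]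

theorem coeff_bPoly₁_succ (f m : ℕ) : (bPoly₁ f).coeff (m + 1) = (f + m).choose (2 * m + 1) := by
  rw [bPoly₁, Polynomial.finsetSum_coeff]
  simp only [Polynomial.coeff_monomial, add_left_inj, Finset.sum_ite_eq', Finset.mem_range]
  split_ifs with h
  · rfl
  · rw [Nat.choose_eq_zero_of_lt (by omega), Nat.cast_zero]

theorem coeff_bPoly₁_zero (f : ℕ) : (bPoly₁ f).coeff 0 = 0 := by
  rw [bPoly₁, Polynomial.finsetSum_coeff]
  exact Finset.sum_eq_zero fun m _ => by simp [Polynomial.coeff_monomial]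

theorem bPoly_zero : bPoly 0 = 1 := by simp [bPoly]

theorem bPoly_one : bPoly 1 = 1 + Polynomial.X := by
  simp [bPoly, Finset.sum_range_succ, ← Polynomial.X_pow_eq_monomial]

theorem bPoly₁_zero : bPoly₁ 0 = 0 := by simp [bPoly₁]

theorem bPoly₁_one : bPoly₁ 1 = Polynomial.X := by
  simp [bPoly₁, ← Polynomial.X_pow_eq_monomial]

/-- Pascal's rule three times. With Y = z - 2 + z⁻¹ the multiplier 2 + Y is z + z⁻¹, so the
characteristic roots are z and z⁻¹. -/
theorem bPoly_add_two (f : ℕ) : bPoly (f + 2) = (2 + Polynomial.X) * bPoly (f + 1) - bPoly f := by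
  ext m
  rw [Polynomial.coeff_sub, add_mul, Polynomial.coeff_add, two_mul, Polynomial.coeff_add]
  cases m with
  | zero => simp [coeff_bPoly]
  | succ m =>
    simp only [Polynomial.coeff_X_mul, coeff_bPoly]
    have h1 : (f + m + 3).choose (2 * m + 2)
      = (f + m + 2).choose (2 * m + 1) + (f + m + 2).choose (2 * m + 2) :=
      Nat.choose_succ_succ _ _
    have h2 : (f + m + 2).choose (2 * m + 2)
      = (f + m + 1).choose (2 * m + 1) + (f + m + 1).choose (2 * m + 2) :=
      Nat.choose_succ_succ _ _
    have h3 : (f + m + 2).choose (2 * m + 1)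
      = (f + m + 1).choose (2 * m) + (f + m + 1).choose (2 * m + 1) := Nat.choose_succ_succ _ _
    rw [show f + 2 + (m + 1) = f + m + 3 by ring, show 2 * (m + 1) = 2 * m + 2 by ring,
      show f + 1 + (m + 1) = f + m + 2 by ring, show f + (m + 1) = f + m + 1 by ring,
      show f + 1 + m = f + m + 1 by ring]
    omega

theorem bPoly₁_add_two (f : ℕ) :
    bPoly₁ (f + 2) = (2 + Polynomial.X) * bPoly₁ (f + 1) - bPoly₁ f := by
  ext m
  rw [Polynomial.coeff_sub, add_mul, Polynomial.coeff_add, two_mul, Polynomial.coeff_add]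
  match m with
  | 0 => simp [coeff_bPoly₁_zero]
  | 1 =>
    rw [Polynomial.coeff_X_mul, coeff_bPoly₁_zero, coeff_bPoly₁_succ, coeff_bPoly₁_succ,
      coeff_bPoly₁_succ]
    simp
    ring
  | m + 2 =>
    rw [Polynomial.coeff_X_mul]
    simp only [coeff_bPoly₁_succ]
    have h1 : (f + m + 3).choose (2 * m + 3)
      = (f + m + 2).choose (2 * m + 2) + (f + m + 2).choose (2 * m + 3) :=
      Nat.choose_succ_succ _ _
    have h2 : (f + m + 2).choose (2 * m + 3)
      = (f + m + 1).choose (2 * m + 2) + (f + m + 1).choose (2 * m + 3) :=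
      Nat.choose_succ_succ _ _
    have h3 : (f + m + 2).choose (2 * m + 2)
      = (f + m + 1).choose (2 * m + 1) + (f + m + 1).choose (2 * m + 2) :=
      Nat.choose_succ_succ _ _
    rw [show f + 2 + (m + 1) = f + m + 3 by ring,
      show 2 * (m + 1) + 1 = 2 * m + 3 by ring, show f + 1 + (m + 1) = f + m + 2 by ring,
      show f + (m + 1) = f + m + 1 by ring, show f + 1 + m = f + m + 1 by ring]
    omega

theorem getElem_sort_zero {s : Finset ℕ} {a : ℕ} (ha : a ∈ s) (hmin : ∀ b ∈ s, a ≤ b) :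
    (s.sort (· ≤ ·)).getD 0 0 = a := by
  have h0 : 0 < (s.sort (· ≤ ·)).length := by
    rw [Finset.length_sort]
    exact Finset.card_pos.2 ⟨a, ha⟩
  rw [List.getD_eq_getElem _ _ h0]
  apply le_antisymm
  · obtain ⟨i, hi, hia⟩ := List.getElem_of_mem ((Finset.mem_sort (· ≤ ·)).2 ha)
    rw [← hia]
    exact (Finset.sortedLT_sort s).strictMono_get.monotone (a := ⟨0, h0⟩) (b := ⟨i, hi⟩) (Nat.zero_le i)
  · exact hmin _ ((Finset.mem_sort (· ≤ ·)).1 (List.getElem_mem h0))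

theorem smallestPart_eq {s : Multiset ℕ} {a : ℕ} (ha : a ∈ s) (hmin : ∀ b ∈ s, a ≤ b) :
    smallestPart s = a :=
  getElem_sort_zero (Multiset.mem_toFinset.2 ha) fun b hb => hmin b (Multiset.mem_toFinset.1 hb)

theorem freq_one {s : Multiset ℕ} {a : ℕ} (ha : a ∈ s) (hmin : ∀ b ∈ s, a ≤ b) :
    freq s 1 = s.count a := by
  have hc : 1 ≤ s.toFinset.card := Finset.card_pos.2 ⟨a, Multiset.mem_toFinset.2 ha⟩
  rw [freq, if_pos hc, ← smallestPart, smallestPart_eq ha hmin]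

/-- Passes from indexing by rank in the sorted list of parts, as in ω_k, to indexing by the parts
themselves, as in the Euler products. -/
theorem prod_freq {M : Type*} [CommMonoid M] {s : Multiset ℕ} {a : ℕ} (ha : a ∈ s)
    (hmin : ∀ b ∈ s, a ≤ b) (F : ℕ → M) :
    ∏ j ∈ Icc 2 s.toFinset.card, F (freq s j) = ∏ i ∈ s.toFinset.erase a, F (s.count i) := by
  have hlen : (s.toFinset.sort (· ≤ ·)).length = s.toFinset.card := Finset.length_sort _
  have hnd : (s.toFinset.sort (· ≤ ·)).Nodup := Finset.sort_nodup _ _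
  have hget : ∀ j ∈ Icc 2 s.toFinset.card, ∃ h : j - 1 < (s.toFinset.sort (· ≤ ·)).length,
      distinctPart s j = (s.toFinset.sort (· ≤ ·))[j - 1] := by
    intro j hj
    rw [Finset.mem_Icc] at hj
    have h : j - 1 < (s.toFinset.sort (· ≤ ·)).length := by omega
    exact ⟨h, List.getD_eq_getElem _ _ h⟩
  have ha' : ∃ h : 0 < (s.toFinset.sort (· ≤ ·)).length, a = (s.toFinset.sort (· ≤ ·))[0] := by
    have h0 : 0 < (s.toFinset.sort (· ≤ ·)).length := by
      rw [hlen]; exact Finset.card_pos.2 ⟨a, Multiset.mem_toFinset.2 ha⟩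
    refine ⟨h0, ?_⟩
    rw [← List.getD_eq_getElem _ 0 h0]
    exact (smallestPart_eq ha hmin).symm
  obtain ⟨h0, ha'⟩ := ha'
  refine Finset.prod_bij (fun j _ => distinctPart s j) ?_ ?_ ?_ ?_
  · intro j hj
    obtain ⟨h, h'⟩ := hget j hj
    rw [Finset.mem_erase]
    refine ⟨?_, ?_⟩
    · rw [h', ha', Ne, hnd.getElem_inj_iff]
      rw [Finset.mem_Icc] at hj
      omega
    · rw [h']
      exact (Finset.mem_sort (· ≤ ·)).1 (List.getElem_mem h)
  · intro j hj j' hj' heq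
    obtain ⟨h, h1⟩ := hget j hj
    obtain ⟨h', h2⟩ := hget j' hj'
    simp only [h1, h2] at heq
    rw [hnd.getElem_inj_iff] at heq
    rw [Finset.mem_Icc] at hj hj'
    omega
  · intro b hb
    rw [Finset.mem_erase] at hb
    obtain ⟨i, hi, hib⟩ := List.getElem_of_mem ((Finset.mem_sort (· ≤ ·)).2 hb.2)
    have hi0 : i ≠ 0 := by
      rintro rfl
      exact hb.1 (hib.symm.trans ha'.symm)
    have hmem : i + 1 ∈ Icc 2 s.toFinset.card := by
      rw [Finset.mem_Icc]; omega
    obtain ⟨h, h'⟩ := hget (i + 1) hmem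
    exact ⟨i + 1, hmem, by rw [h', ← hib]; rfl⟩
  · intro j hj
    rw [freq, if_pos (Finset.mem_Icc.1 hj).2]

/-- The defining sum of ω_k is the expansion of this product, since `bPoly₁` has no constant term
and `bPoly` has constant term 1. -/
theorem omega_eq_coeff {k : ℕ} (hk : 1 ≤ k) {s : Multiset ℕ} {a : ℕ} (ha : a ∈ s)
    (hmin : ∀ b ∈ s, a ≤ b) :
    (omega k s : ℤ)
      = (bPoly₁ (s.count a) * ∏ i ∈ s.toFinset.erase a, bPoly (s.count i)).coeff k := by
  have h := sum_composition_eq_coeff (A := ℤ) (Icc 2 s.toFinset.card)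
    (fun m => ((freq s 1 + m - 1).choose (2 * m - 1) : ℤ))
    (fun j m => ((freq s j + m).choose (2 * m) : ℤ)) hk
  rw [omega]
  push_cast
  rw [h, ← prod_freq ha hmin, ← freq_one ha hmin, ← Polynomial.coeff_coe, Polynomial.coe_mul,
    ← Polynomial.coeToPowerSeries.ringHom_apply (φ := ∏ j ∈ _, _), map_prod]
  congr 2
  · ext m
    rw [PowerSeries.coeff_mk, Polynomial.coeff_coe]
    cases m with
    | zero => simp [coeff_bPoly₁_zero]
    | succ m => rw [coeff_bPoly₁_succ, if_neg (Nat.succ_ne_zero m)]; rfl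
  · refine Finset.prod_congr rfl fun j _ => ?_
    ext m
    rw [Polynomial.coeToPowerSeries.ringHom_apply, Polynomial.coeff_coe, coeff_bPoly, map_add,
      PowerSeries.coeff_mk, PowerSeries.coeff_one]
    cases m <;> simp

/-- The linear coefficient of `bPoly₁ f` is binom(f, 1) = f, and the other factors contribute only
their constant term 1. -/
theorem omega_one {s : Multiset ℕ} {a : ℕ} (ha : a ∈ s) (hmin : ∀ b ∈ s, a ≤ b) :
    omega 1 s = s.count a := by
  have h := omega_eq_coeff le_rfl ha hmin
  rw [Polynomial.coeff_mul] at h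
  simp [Finset.Nat.antidiagonal_succ, coeff_bPoly₁_zero, Polynomial.coeff_zero_prod, coeff_bPoly,
    coeff_bPoly₁_succ _ 0] at h
  exact_mod_cast h

end Weights

/-! ### Expansion of the spt terms over partitions. -/

section SptSeries

open PowerSeries Finset

theorem z_mul_zInv : z * zInv = 1 := by
  rw [z, zInv, ← map_mul, ← LaurentPolynomial.T_add]
  simp

theorem C_yy : (C yy : ℤ[T;T⁻¹]⟦X⟧) = z + zInv - 2 := by
  rw [yy, map_sub, map_add, z, zInv, map_ofNat]

theorem one_sub_z_mul_one_sub_zInv (Y : ℤ[T;T⁻¹]⟦X⟧) :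
    (1 - z * Y) * (1 - zInv * Y) = 1 - C (2 + yy) * Y + Y * Y := by
  rw [map_add, C_yy, map_ofNat]
  linear_combination Y * Y * z_mul_zInv

/-- Both sides come from the recurrence with initial values 1 and 1 + Y; the linear term is (1 + Y)
- (2 + Y) = -1. -/
theorem partSeries_bPoly {i : ℕ} (hi : 0 < i) :
    (1 - z * X ^ i) * (1 - zInv * X ^ i) * partSeries i (fun f => Polynomial.aeval yy (bPoly f))
      = 1 - X ^ i := by
  rw [one_sub_z_mul_one_sub_zInv, partSeries_recurrence hi (2 + yy)]
  · simp only [bPoly_zero, bPoly_one, map_add, map_one, Polynomial.aeval_X, map_sub, map_mul,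
      map_ofNat]
    ring
  · intro f
    simp [bPoly_add_two, map_ofNat]

theorem partSeries_bPoly₁ {i : ℕ} (hi : 0 < i) :
    (1 - z * X ^ i) * (1 - zInv * X ^ i) * partSeries i (fun f => Polynomial.aeval yy (bPoly₁ f))
      = C yy * X ^ i := by
  rw [one_sub_z_mul_one_sub_zInv, partSeries_recurrence hi (2 + yy)]
  · simp [bPoly₁_zero, bPoly₁_one]
  · intro f
    simp [bPoly₁_add_two, map_ofNat]

/-- The multiples `c (m + 1), c (m + 2), ..., c (m + 1 + K)`. -/
def sptParts (c m K : ℕ) : Finset ℕ :=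
  insert (c * (m + 1)) ((range K).image fun j => c * (m + 2 + j))

/-- The weights of the parts of the first component with smallest part `c (m + 1)`. -/
noncomputable def sptWeight (c m i f : ℕ) : ℤ[T;T⁻¹] :=
  if i = c * (m + 1) then Polynomial.aeval yy (bPoly₁ f) else Polynomial.aeval yy (bPoly f)

/-- The weight of a partition, relative to a part `a`, as a polynomial in `z - 2 + z⁻¹`. -/
noncomputable def sptPoly (s : Multiset ℕ) (a : ℕ) : ℤ[T;T⁻¹] :=
  Polynomial.aeval yy (bPoly₁ (s.count a) * ∏ i ∈ s.toFinset.erase a, bPoly (s.count i))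

theorem shiftMoment_sptPoly {k : ℕ} (hk : 1 ≤ k) {s : Multiset ℕ} {a : ℕ} (ha : a ∈ s)
    (hmin : ∀ b ∈ s, a ≤ b) :
    shiftMoment ((k : ℤ) - 1) (2 * k) (sptPoly s a) = omega k s := by
  rw [sptPoly, shiftMoment_aeval_yy, omega_eq_coeff hk ha hmin]

theorem sptParts_pos {c : ℕ} (hc : 0 < c) (m K : ℕ) : ∀ i ∈ sptParts c m K, 0 < i := by
  intro i hi
  rw [sptParts, Finset.mem_insert, Finset.mem_image] at hi
  rcases hi with rfl | ⟨j, _, rfl⟩ <;> positivity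

/-- Each of the K + 1 parts i supplies one pair (1 - zX^i)(1 - z⁻¹X^i); the smallest part leaves the
numerator Y X^i and the other K leave 1 - X^i. -/
theorem gf_sptWeight_mul {c : ℕ} (hc : 0 < c) (m K : ℕ) :
    gf (partsWeight (sptParts c m K) (sptWeight c m))
        * (qPoch (z * (X ^ c) ^ (m + 1)) (X ^ c) (K + 1)
          * qPoch (zInv * (X ^ c) ^ (m + 1)) (X ^ c) (K + 1))
      = C yy * (X ^ c) ^ (m + 1) * qPoch ((X ^ c) ^ (m + 2)) (X ^ c) K := by
  have hinj : Set.InjOn (fun j => c * (m + 2 + j)) (range K : Set ℕ) := by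
    intro j _ j' _ h
    have := Nat.eq_of_mul_eq_mul_left hc h
    omega
  have hnot : c * (m + 1) ∉ (range K).image fun j => c * (m + 2 + j) := by
    intro h
    obtain ⟨j, _, h⟩ := Finset.mem_image.1 h
    have := Nat.eq_of_mul_eq_mul_left hc h
    omega
  rw [gf_partsWeight _ (sptParts_pos hc m K), sptParts, Finset.prod_insert hnot,
    Finset.prod_image hinj, qPoch, qPoch, qPoch, Finset.prod_range_succ', Finset.prod_range_succ']
  have h0 : partSeries (c * (m + 1)) (sptWeight c m (c * (m + 1)))
      = partSeries (c * (m + 1)) (fun f => Polynomial.aeval yy (bPoly₁ f)) := by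
    congr 1
    funext f
    exact if_pos rfl
  have h1 : ∀ j, partSeries (c * (m + 2 + j)) (sptWeight c m (c * (m + 2 + j)))
      = partSeries (c * (m + 2 + j)) (fun f => Polynomial.aeval yy (bPoly f)) := by
    intro j
    congr 1
    funext f
    refine if_neg fun h => ?_
    have := Nat.eq_of_mul_eq_mul_left hc h
    omega
  simp only [h0, h1]
  have e0 := partSeries_bPoly₁ (show 0 < c * (m + 1) by positivity)
  have e1 : ∏ j ∈ range K, ((1 - z * (X ^ c) ^ (m + 1) * (X ^ c) ^ (j + 1))
      * (1 - zInv * (X ^ c) ^ (m + 1) * (X ^ c) ^ (j + 1))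
        * partSeries (c * (m + 2 + j)) (fun f => Polynomial.aeval yy (bPoly f)))
      = ∏ j ∈ range K, (1 - (X ^ c) ^ (m + 2) * (X ^ c) ^ j) := by
    refine Finset.prod_congr rfl fun j _ => ?_
    have := partSeries_bPoly (Nat.mul_pos hc (show 0 < m + 2 + j by omega))
    rw [show z * (X ^ c) ^ (m + 1) * (X ^ c) ^ (j + 1) = z * X ^ (c * (m + 2 + j)) by ring,
      show zInv * (X ^ c) ^ (m + 1) * (X ^ c) ^ (j + 1) = zInv * X ^ (c * (m + 2 + j)) by ring,
      this]
    ring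
  rw [Finset.prod_mul_distrib, Finset.prod_mul_distrib] at e1
  rw [← e1, ← pow_mul, ← e0]
  ring

theorem X_pow_dvd_gf_sptWeight_sub {c : ℕ} (hc : 0 < c) (m K : ℕ) :
    X ^ K ∣ gf (partsWeight (sptParts c m K) (sptWeight c m))
      - (z + zInv - 2) * (X ^ c) ^ (m + 1) * psInv (qPochInf (z * (X ^ c) ^ (m + 1)) (X ^ c))
        * psInv (qPochInf (zInv * (X ^ c) ^ (m + 1)) (X ^ c))
        * qPochInf ((X ^ c) ^ (m + 2)) (X ^ c) := by
  have hQ : (X : ℤ[T;T⁻¹]⟦X⟧) ∣ X ^ c := dvd_pow_self X hc.ne'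
  have hQ' : (X : ℤ[T;T⁻¹]⟦X⟧) ∣ (X ^ c) ^ (m + 1) := hQ.trans (dvd_pow_self _ (Nat.succ_ne_zero m))
  have h := gf_sptWeight_mul hc m K
  obtain ⟨u, hu⟩ := (pow_dvd_pow _ (Nat.le_succ K)).trans
    (X_pow_dvd_qPochInf_sub_qPoch (z * (X ^ c) ^ (m + 1)) hQ (K + 1))
  obtain ⟨v, hv⟩ := (pow_dvd_pow _ (Nat.le_succ K)).trans
    (X_pow_dvd_qPochInf_sub_qPoch (zInv * (X ^ c) ^ (m + 1)) hQ (K + 1))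
  obtain ⟨t, ht⟩ := X_pow_dvd_qPochInf_sub_qPoch ((X ^ c) ^ (m + 2) : ℤ[T;T⁻¹]⟦X⟧) hQ K
  have hz := qPochInf_mul_psInv (z * (X ^ c) ^ (m + 1)) (X ^ c) (hQ'.mul_left z)
  have hw := qPochInf_mul_psInv (zInv * (X ^ c) ^ (m + 1)) (X ^ c) (hQ'.mul_left zInv)
  rw [C_yy] at h
  set G := gf (partsWeight (sptParts c m K) (sptWeight c m))
  set pz := qPochInf (z * (X ^ c) ^ (m + 1)) (X ^ c)
  set pw := qPochInf (zInv * (X ^ c) ^ (m + 1)) (X ^ c)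
  set fz := qPoch (z * (X ^ c) ^ (m + 1)) (X ^ c) (K + 1)
  set fw := qPoch (zInv * (X ^ c) ^ (m + 1)) (X ^ c) (K + 1)
  set iz := psInv pz
  set iw := psInv pw
  refine ⟨G * iz * iw * (u * pw + fz * v) - (z + zInv - 2) * (X ^ c) ^ (m + 1) * iz * iw * t, ?_⟩
  linear_combination (iz * iw) * h + G * iz * iw * (pw * hu + fz * hv)
    - (z + zInv - 2) * (X ^ c) ^ (m + 1) * iz * iw * ht - G * hz - G * pz * iz * hw

/-- As `bPoly₁ 0 = 0`, the part c(m+1) must occur, and it is then the smallest one. -/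
theorem mem_of_partsWeight_ne_zero {c m K : ℕ} {s : Multiset ℕ}
    (h : partsWeight (sptParts c m K) (sptWeight c m) s ≠ 0) :
    c * (m + 1) ∈ s ∧ ∀ b ∈ s, c * (m + 1) ≤ b ∧ c ∣ b := by
  rw [partsWeight] at h
  split_ifs at h with hs
  · refine ⟨?_, fun b hb => ?_⟩
    · have := Finset.prod_ne_zero_iff.1 h (c * (m + 1)) (Finset.mem_insert_self _ _)
      by_contra hmem
      rw [Multiset.count_eq_zero_of_notMem hmem, sptWeight, if_pos rfl, bPoly₁_zero, map_zero]
        at this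
      exact this rfl
    · have := hs b hb
      rw [sptParts, Finset.mem_insert, Finset.mem_image] at this
      rcases this with rfl | ⟨j, _, rfl⟩
      · exact ⟨le_rfl, dvd_mul_right _ _⟩
      · exact ⟨Nat.mul_le_mul_left c (by omega), dvd_mul_right _ _⟩
  · exact absurd rfl h

theorem partsWeight_sptParts {c m K : ℕ} {s : Multiset ℕ}
    (hs : ∀ b ∈ s, c * (m + 1) ≤ b ∧ c ∣ b) (hc : 0 < c) (hK : ∀ b ∈ s, b ≤ K) :
    partsWeight (sptParts c m K) (sptWeight c m) s = sptPoly s (c * (m + 1)) := by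
  have hsub : ∀ b ∈ s, b ∈ sptParts c m K := by
    intro b hb
    obtain ⟨h1, j, rfl⟩ := hs b hb
    rw [sptParts, Finset.mem_insert, Finset.mem_image]
    have h1' := Nat.le_of_mul_le_mul_left h1 hc
    rcases h1'.eq_or_lt with h | h
    · left; rw [h]
    · right
      have hj : j ≤ c * j := Nat.le_mul_of_pos_left j hc
      have := hK _ hb
      exact ⟨j - (m + 2), Finset.mem_range.2 (by omega), by congr 1; omega⟩
  have hself : c * (m + 1) ∈ sptParts c m K := Finset.mem_insert_self _ _
  rw [partsWeight, if_pos hsub, sptPoly, map_mul, map_prod, ← Finset.mul_prod_erase _ _ hself]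
  congr 1
  · exact if_pos rfl
  · symm
    rw [Finset.prod_subset (Finset.erase_subset_erase _
      fun i hi => hsub i (Multiset.mem_toFinset.1 hi))]
    · exact Finset.prod_congr rfl fun i hi => (if_neg (Finset.ne_of_mem_erase hi)).symm
    · intro i h1 h2
      have : i ∉ s := fun h =>
        h2 (Finset.mem_erase.2 ⟨Finset.ne_of_mem_erase h1, Multiset.mem_toFinset.2 h⟩)
      rw [Multiset.count_eq_zero_of_notMem this, bPoly_zero, map_one]

/-- The index is determined by the smallest part, so a single term of the sum survives. -/
theorem sum_partsWeight_mul {c m N : ℕ} {s : Multiset ℕ} (hmem : c * (m + 1) ∈ s)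
    (hs : ∀ b ∈ s, c * (m + 1) ≤ b ∧ c ∣ b) (hc : 0 < c) (hN : ∀ b ∈ s, b < N)
    (v : ℕ → ℤ[T;T⁻¹]) :
    ∑ l ∈ range N, partsWeight (sptParts c l N) (sptWeight c l) s * v l
      = sptPoly s (c * (m + 1)) * v m := by
  rw [Finset.sum_eq_single m, partsWeight_sptParts hs hc fun b hb => (hN b hb).le]
  · intro l _ hl
    by_contra h
    obtain ⟨h1, h2⟩ := mem_of_partsWeight_ne_zero (left_ne_zero_of_mul h)
    have := Nat.eq_of_mul_eq_mul_left hc (le_antisymm (h2 _ hmem).1 (hs _ h1).1)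
    omega
  · intro h
    have h1 := hN _ hmem
    have h2 : m + 1 ≤ c * (m + 1) := Nat.le_mul_of_pos_left _ hc
    exact absurd (Finset.mem_range.2 (by omega)) h

theorem sum_partsWeight_mul_eq_zero {c N : ℕ} {s : Multiset ℕ} {v : ℕ → ℤ[T;T⁻¹]}
    (h : ∀ m, c * (m + 1) ∈ s → (∀ b ∈ s, c * (m + 1) ≤ b ∧ c ∣ b) → v m = 0) :
    ∑ l ∈ range N, partsWeight (sptParts c l N) (sptWeight c l) s * v l = 0 := by
  refine Finset.sum_eq_zero fun l _ => ?_
  by_contra hne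
  obtain ⟨h1, h2⟩ := mem_of_partsWeight_ne_zero (left_ne_zero_of_mul hne)
  exact right_ne_zero_of_mul hne (h l h1 h2)

/-- The weights of the multiplicities of parts that are not repeated, contributing `c i` each. -/
def distinctWeight {R : Type*} [CommRing R] (c : ℕ → R) (i f : ℕ) : R :=
  if f = 0 then 1 else if f = 1 then c i else 0

/-- Covers all the restrictions in use: p true for distinct parts, p false for unrestricted ones,
and p = `Odd` for distinct odd parts. -/
theorem partsWeight_mixed {R : Type*} [CommRing R] (P : Finset ℕ) (p : ℕ → Prop)
    [DecidablePred p] (c : ℕ → R) (s : Multiset ℕ) :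
    partsWeight P (fun i f => if p i then distinctWeight c i f else c i ^ f) s
      = if (∀ i ∈ s, i ∈ P) ∧ ∀ i ∈ s, p i → s.count i = 1 then (s.map c).prod else 0 := by
  by_cases hs : ∀ i ∈ s, i ∈ P
  · rw [partsWeight, if_pos hs]
    split_ifs with h
    · rw [Finset.prod_multiset_map_count]
      symm
      rw [Finset.prod_subset fun i hi => hs i (Multiset.mem_toFinset.1 hi)]
      · refine Finset.prod_congr rfl fun i _ => ?_
        by_cases hp : p i
        · rw [if_pos hp, distinctWeight]
          by_cases hi : i ∈ s
          · simp [h.2 i hi hp]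
          · simp [hi]
        · rw [if_neg hp]
      · intro i _ hi
        rw [Multiset.mem_toFinset] at hi
        simp [hi]
    · have hn : ¬ ∀ i ∈ s, p i → s.count i = 1 := fun h' => h ⟨hs, h'⟩
      push Not at hn
      obtain ⟨i, hi, hp, h1⟩ := hn
      have := Multiset.count_pos.2 hi
      refine Finset.prod_eq_zero (hs i hi) ?_
      rw [if_pos hp, distinctWeight, if_neg (by omega), if_neg h1]
  · rw [partsWeight, if_neg hs, if_neg fun h => hs h.1]

theorem partsWeight_distinctWeight {R : Type*} [CommRing R] (P : Finset ℕ) (c : ℕ → R)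
    (s : Multiset ℕ) :
    partsWeight P (distinctWeight c) s
      = if (∀ i ∈ s, i ∈ P) ∧ s.Nodup then (s.map c).prod else 0 := by
  have h := partsWeight_mixed P (fun _ => True) c s
  simp only [if_true, true_implies] at h
  rw [show (distinctWeight c) = fun i f => distinctWeight c i f from rfl, h]
  congr 2
  rw [Multiset.nodup_iff_count_eq_one]

theorem partsWeight_pow {R : Type*} [CommRing R] (P : Finset ℕ) (c : ℕ → R) (s : Multiset ℕ) :
    partsWeight P (fun i f => c i ^ f) s
      = if ∀ i ∈ s, i ∈ P then (s.map c).prod else 0 := by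
  have h := partsWeight_mixed P (fun _ => False) c s
  simpa using h

theorem partsWeight_distinct {R : Type*} [CommRing R] (P : Finset ℕ) (s : Multiset ℕ) :
    partsWeight P (distinctWeight fun _ => (1 : R)) s
      = if (∀ i ∈ s, i ∈ P) ∧ s.Nodup then 1 else 0 := by
  rw [partsWeight_distinctWeight]
  simp

theorem partsWeight_one {R : Type*} [CommRing R] (P : Finset ℕ) (s : Multiset ℕ) :
    partsWeight P (fun _ _ => (1 : R)) s = if ∀ i ∈ s, i ∈ P then 1 else 0 := by
  simp [partsWeight]

theorem le_of_mem_of_sum_eq {s : Multiset ℕ} {b : ℕ} (hb : b ∈ s) : b ≤ s.sum :=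
  Multiset.single_le_sum (fun _ _ => Nat.zero_le _) _ hb

theorem mem_image_add {a d N b : ℕ} :
    b ∈ (range N).image (fun j => a + d * j) ↔ ∃ j < N, b = a + d * j := by
  simp [eq_comm]

end SptSeries

/-! ### The three sums of ω_k as moments of the spt series. -/

section SptSums

open PowerSeries Finset

theorem gf_distinct_progression {R : Type*} [CommRing R] {a d : ℕ} (ha : 0 < a) (hd : 0 < d) (N : ℕ) :
    gf (partsWeight ((range N).image fun j => a + d * j) (distinctWeight fun _ => (1 : R)))
      = qPoch (-X ^ a) (X ^ d) N := by
  rw [gf_partsWeight, Finset.prod_image, qPoch]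
  · refine Finset.prod_congr rfl fun j _ => ?_
    have := partSeries_distinct (show 0 < a + d * j by omega) (1 : R)
    rw [show partSeries (a + d * j) (distinctWeight (fun _ => (1 : R)) (a + d * j))
      = 1 + C (1 : R) * X ^ (a + d * j) from this, map_one]
    ring
  · intro j _ j' _ h
    exact Nat.eq_of_mul_eq_mul_left hd (Nat.add_left_cancel h)
  · intro i hi
    obtain ⟨j, _, rfl⟩ := mem_image_add.1 hi
    omega

theorem qPoch_mul_gf_progression {R : Type*} [CommRing R] {a d : ℕ} (ha : 0 < a) (hd : 0 < d)
    (N : ℕ) :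
    qPoch (X ^ a) (X ^ d) N * gf (partsWeight ((range N).image fun j => a + d * j)
      (fun _ _ => (1 : R))) = 1 := by
  rw [gf_partsWeight, Finset.prod_image, qPoch, ← Finset.prod_mul_distrib]
  · refine Finset.prod_eq_one fun j _ => ?_
    have := partSeries_geom (show 0 < a + d * j by omega) (1 : R)
    simp only [one_pow, map_one, one_mul] at this
    rwa [pow_add, pow_mul] at this
  · intro j _ j' _ h
    exact Nat.eq_of_mul_eq_mul_left hd (Nat.add_left_cancel h)
  · intro i hi
    obtain ⟨j, _, rfl⟩ := mem_image_add.1 hi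
    omega

theorem X_pow_dvd_mul_sub_mul {R : Type*} [CommRing R] {N : ℕ} {a b c d : R⟦X⟧}
    (h1 : X ^ N ∣ a - b) (h2 : X ^ N ∣ c - d) : X ^ N ∣ a * c - b * d := by
  obtain ⟨u, hu⟩ := h1
  obtain ⟨v, hv⟩ := h2
  exact ⟨u * c + b * v, by linear_combination c * hu + b * hv⟩

theorem coeff_eq_of_X_pow_dvd_sub {R : Type*} [CommRing R] {N n : ℕ} {a b : R⟦X⟧}
    (h : X ^ N ∣ a - b) (hn : n < N) : coeff n a = coeff n b :=
  sub_eq_zero.1 <| by rw [← map_sub]; exact X_pow_dvd_iff.1 h n hn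

/-- The generating function of the vector partitions weighted by `ω`, for the base `q ^ c`, with
other components counted by `restSeries`. -/
noncomputable def sptSeries (c N : ℕ) (α h : ℤ[T;T⁻¹]⟦X⟧) : ℤ[T;T⁻¹]⟦X⟧ :=
  ∑ n ∈ range N, (z + zInv - 2) * (X ^ c) ^ (n + 1)
    * psInv (qPochInf (z * (X ^ c) ^ (n + 1)) (X ^ c))
    * psInv (qPochInf (zInv * (X ^ c) ^ (n + 1)) (X ^ c))
    * qPochInf ((X ^ c) ^ (n + 2)) (X ^ c) * restSeries (X ^ c) α h (n + 1)

theorem X_pow_dvd_sum_sub_sptSeries {c N : ℕ} (hc : 0 < c) {α h : ℤ[T;T⁻¹]⟦X⟧}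
    {F : ℕ → ℤ[T;T⁻¹]⟦X⟧} (hF : ∀ m, X ^ N ∣ F m - restSeries (X ^ c) α h (m + 1)) :
    X ^ N ∣ ∑ m ∈ range N, gf (partsWeight (sptParts c m N) (sptWeight c m)) * F m
      - sptSeries c N α h := by
  rw [sptSeries, ← Finset.sum_sub_distrib]
  exact Finset.dvd_sum fun m _ => X_pow_dvd_mul_sub_mul (X_pow_dvd_gf_sptWeight_sub hc m N) (hF m)

theorem restSeries_of_zero {Q α : ℤ[T;T⁻¹]⟦X⟧} (hQ : X ∣ Q) (n : ℕ) :
    restSeries Q α 0 n = qPochInf (α * Q ^ n) Q := by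
  simp [restSeries, qPochInf_zero hQ, psInv_one]

/-- For Q = q, α = -q, h = 0 the remaining factor is (-q^{m+2}; q)_∞: distinct overlined parts above
the smallest part m + 1. Truncation modulo `X ^ (n + 1)` does not affect the coefficient of q^n. -/
theorem sum_SBar {k : ℕ} (hk : 1 ≤ k) (n : ℕ) :
    ∑ π ∈ SBar n, (omega k π.1 : ℤ) = shiftMoment ((k : ℤ) - 1) (2 * k)
      (coeff n (sptSeries 1 (n + 1) (-X) 0)) := by
  rw [← coeff_eq_of_X_pow_dvd_sub (X_pow_dvd_sum_sub_sptSeries (α := -X) (h := 0) one_pos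
    (F := fun m => gf (partsWeight ((range (n + 1)).image fun j => m + 2 + 1 * j)
      (distinctWeight fun _ => (1 : ℤ[T;T⁻¹])))) fun m => ?_) (Nat.lt_add_one n)]
  · rw [map_sum]
    simp only [← sum_partitionPairs]
    rw [Finset.sum_comm, SBar, Finset.sum_filter, map_sum]
    refine Finset.sum_congr rfl fun π hπ => ?_
    obtain ⟨h1, h2, h3⟩ := mem_partitionPairs.1 hπ
    have hlt : ∀ b ∈ π.1, b < n + 1 := fun b hb => by
      have := le_of_mem_of_sum_eq hb
      omega
    split_ifs with h
    · obtain ⟨hnd, a, ha, hmin, hlow⟩ := h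
      rw [Multiset.mem_toFinset] at ha
      obtain ⟨m, rfl⟩ : ∃ m, a = 1 * (m + 1) := ⟨a - 1, by have := h1 a ha; omega⟩
      rw [sum_partsWeight_mul ha (fun b hb => ⟨hmin b hb, one_dvd b⟩) one_pos hlt
        (fun m => partsWeight ((range (n + 1)).image fun j => m + 2 + 1 * j)
          (distinctWeight fun _ => (1 : ℤ[T;T⁻¹])) π.2), partsWeight_distinct, if_pos, mul_one,
        shiftMoment_sptPoly hk ha hmin]
      refine ⟨fun b hb => mem_image_add.2 ⟨b - (m + 2), ?_⟩, hnd⟩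
      have := hlow b hb
      have := le_of_mem_of_sum_eq hb
      omega
    · rw [sum_partsWeight_mul_eq_zero (v := fun m => partsWeight
        ((range (n + 1)).image fun j => m + 2 + 1 * j)
          (distinctWeight fun _ => (1 : ℤ[T;T⁻¹])) π.2), map_zero]
      intro m hm hmin
      rw [partsWeight_distinct, if_neg]
      rintro ⟨hP, hnd⟩
      refine h ⟨hnd, _, Multiset.mem_toFinset.2 hm, fun b hb => (hmin b hb).1, fun b hb => ?_⟩
      obtain ⟨j, _, rfl⟩ := mem_image_add.1 (hP b hb)
      omega
  · rw [gf_distinct_progression (by omega) one_pos, restSeries_of_zero (by simp)]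
    rw [← neg_sub, dvd_neg]
    convert X_pow_dvd_qPochInf_sub_qPoch _ _ (n + 1) using 3
    · ring
    · simp

/-- For Q = q² the remaining factor is (-q^{2m+3}; q²)_∞: distinct odd parts above the smallest part
2m + 2. -/
theorem sum_S2 {k : ℕ} (hk : 1 ≤ k) (n : ℕ) :
    ∑ π ∈ S2 n, (omega k π.1 : ℤ) = shiftMoment ((k : ℤ) - 1) (2 * k)
      (coeff n (sptSeries 2 (n + 1) (-X) 0)) := by
  rw [← coeff_eq_of_X_pow_dvd_sub (X_pow_dvd_sum_sub_sptSeries (α := -X) (h := 0) two_pos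
    (F := fun m => gf (partsWeight ((range (n + 1)).image fun j => 2 * m + 3 + 2 * j)
      (distinctWeight fun _ => (1 : ℤ[T;T⁻¹])))) fun m => ?_) (Nat.lt_add_one n)]
  · rw [map_sum]
    simp only [← sum_partitionPairs]
    rw [Finset.sum_comm, S2, Finset.sum_filter, map_sum]
    refine Finset.sum_congr rfl fun π hπ => ?_
    obtain ⟨h1, h2, h3⟩ := mem_partitionPairs.1 hπ
    have hlt : ∀ b ∈ π.1, b < n + 1 := fun b hb => by
      have := le_of_mem_of_sum_eq hb
      omega
    split_ifs with h
    · obtain ⟨heven, hodd, hnd, a, ha, hmin, hlow⟩ := h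
      rw [Multiset.mem_toFinset] at ha
      obtain ⟨m, rfl⟩ : ∃ m, a = 2 * (m + 1) := by
        obtain ⟨r, hr⟩ := (heven a ha).two_dvd
        exact ⟨r - 1, by have := h1 a ha; omega⟩
      rw [sum_partsWeight_mul ha (fun b hb => ⟨hmin b hb, (heven b hb).two_dvd⟩) two_pos hlt
        (fun m => partsWeight ((range (n + 1)).image fun j => 2 * m + 3 + 2 * j)
          (distinctWeight fun _ => (1 : ℤ[T;T⁻¹])) π.2), partsWeight_distinct, if_pos, mul_one,
        shiftMoment_sptPoly hk ha hmin]
      refine ⟨fun b hb => mem_image_add.2 ⟨(b - (2 * m + 3)) / 2, ?_⟩, hnd⟩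
      have := hlow b hb
      have := le_of_mem_of_sum_eq hb
      have := Nat.odd_iff.1 (hodd b hb)
      omega
    · rw [sum_partsWeight_mul_eq_zero (v := fun m => partsWeight
        ((range (n + 1)).image fun j => 2 * m + 3 + 2 * j)
          (distinctWeight fun _ => (1 : ℤ[T;T⁻¹])) π.2), map_zero]
      intro m hm hmin
      rw [partsWeight_distinct, if_neg]
      rintro ⟨hP, hnd⟩
      refine h ⟨fun b hb => even_iff_two_dvd.2 (hmin b hb).2, fun b hb => ?_, hnd, _,
        Multiset.mem_toFinset.2 hm, fun b hb => (hmin b hb).1, fun b hb => ?_⟩ <;>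
      · obtain ⟨j, _, rfl⟩ := mem_image_add.1 (hP b hb)
        first | omega | exact Nat.odd_iff.2 (by omega)
  · have hQ : (X : ℤ[T;T⁻¹]⟦X⟧) ∣ X ^ 2 := dvd_pow_self X two_ne_zero
    rw [gf_distinct_progression (by omega) two_pos, restSeries_of_zero hQ]
    rw [← neg_sub, dvd_neg]
    convert X_pow_dvd_qPochInf_sub_qPoch _ hQ (n + 1) using 3
    ring

/-- For Q = q², h = -1 the remaining factor is (-q^{2m+3}; q²)_∞ (-q^{2m+4}; q²)_∞ / (q^{2m+3};
q²)_∞: the first two products are the distinct overlined parts of either parity, the denominator the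
non-overlined odd parts. -/
theorem sum_SBar2 {k : ℕ} (hk : 1 ≤ k) (n : ℕ) :
    ∑ π ∈ SBar2 n, (omega k π.1 : ℤ) = shiftMoment ((k : ℤ) - 1) (2 * k)
      (coeff n (sptSeries 2 (n + 1) (-X) (-1))) := by
  -- The overlined parts run through 2(n + 1) consecutive integers, so that `qPoch_two_mul` splits
  -- their product into two products of length n + 1 with base q².
  rw [← coeff_eq_of_X_pow_dvd_sub (X_pow_dvd_sum_sub_sptSeries (α := -X) (h := -1) two_pos
    (F := fun m => gf (partsWeight ((range (n + 1)).image fun j => 2 * m + 3 + 2 * j)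
        (fun _ _ => (1 : ℤ[T;T⁻¹]))) * gf (partsWeight ((range (2 * (n + 1))).image
          fun j => 2 * m + 3 + 1 * j) (distinctWeight fun _ => (1 : ℤ[T;T⁻¹])))) fun m => ?_)
      (Nat.lt_add_one n)]
  · rw [map_sum]
    simp only [← sum_partitionTriples]
    rw [Finset.sum_comm, SBar2, Finset.sum_filter, map_sum]
    refine Finset.sum_congr rfl fun π hπ => ?_
    obtain ⟨h1, h2, h3, h4⟩ := mem_partitionTriples.1 hπ
    have hlt : ∀ b ∈ π.1, b < n + 1 := fun b hb => by
      have := le_of_mem_of_sum_eq hb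
      omega
    split_ifs with h
    · obtain ⟨heven, hodd, hnd, a, ha, hmin, hlow, hlow'⟩ := h
      rw [Multiset.mem_toFinset] at ha
      obtain ⟨m, rfl⟩ : ∃ m, a = 2 * (m + 1) := by
        obtain ⟨r, hr⟩ := (heven a ha).two_dvd
        exact ⟨r - 1, by have := h1 a ha; omega⟩
      rw [sum_partsWeight_mul ha (fun b hb => ⟨hmin b hb, (heven b hb).two_dvd⟩) two_pos hlt
        (fun m => partsWeight ((range (n + 1)).image fun j => 2 * m + 3 + 2 * j)
          (fun _ _ => (1 : ℤ[T;T⁻¹])) π.2.1 * partsWeight ((range (2 * (n + 1))).image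
            fun j => 2 * m + 3 + 1 * j) (distinctWeight fun _ => (1 : ℤ[T;T⁻¹])) π.2.2),
        partsWeight_distinct, partsWeight_one, if_pos, if_pos, mul_one, mul_one,
        shiftMoment_sptPoly hk ha hmin]
      · refine ⟨fun b hb => mem_image_add.2 ⟨b - (2 * m + 3), ?_⟩, hnd⟩
        have := hlow' b hb
        have := le_of_mem_of_sum_eq hb
        omega
      · refine fun b hb => mem_image_add.2 ⟨(b - (2 * m + 3)) / 2, ?_⟩
        have := hlow b hb
        have := le_of_mem_of_sum_eq hb
        have := Nat.odd_iff.1 (hodd b hb)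
        omega
    · rw [sum_partsWeight_mul_eq_zero (v := fun m => partsWeight
        ((range (n + 1)).image fun j => 2 * m + 3 + 2 * j)
          (fun _ _ => (1 : ℤ[T;T⁻¹])) π.2.1 * partsWeight ((range (2 * (n + 1))).image
            fun j => 2 * m + 3 + 1 * j) (distinctWeight fun _ => (1 : ℤ[T;T⁻¹])) π.2.2), map_zero]
      intro m hm hmin
      by_contra hne
      have hne1 := left_ne_zero_of_mul hne
      have hne2 := right_ne_zero_of_mul hne
      rw [partsWeight_one, ite_ne_right_iff] at hne1
      rw [partsWeight_distinct, ite_ne_right_iff] at hne2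
      refine h ⟨fun b hb => even_iff_two_dvd.2 (hmin b hb).2, fun b hb => ?_, hne2.1.2, _,
        Multiset.mem_toFinset.2 hm, fun b hb => (hmin b hb).1, fun b hb => ?_, fun b hb => ?_⟩
      · obtain ⟨j, _, rfl⟩ := mem_image_add.1 (hne1.1 b hb)
        exact Nat.odd_iff.2 (by omega)
      · obtain ⟨j, _, rfl⟩ := mem_image_add.1 (hne1.1 b hb)
        omega
      · obtain ⟨j, _, rfl⟩ := mem_image_add.1 (hne2.1.1 b hb)
        omega
  · have hQ : (X : ℤ[T;T⁻¹]⟦X⟧) ∣ X ^ 2 := dvd_pow_self X two_ne_zero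
    have hg := qPoch_mul_gf_progression (R := ℤ[T;T⁻¹]) (show 0 < 2 * m + 3 by omega) two_pos (n + 1)
    have hinv := qPochInf_mul_psInv (X ^ (2 * m + 3) : ℤ[T;T⁻¹]⟦X⟧) (X ^ 2)
      (dvd_pow_self X (Nat.succ_ne_zero _))
    have e1 := X_pow_dvd_qPochInf_sub_qPoch (-X ^ (2 * m + 3) : ℤ[T;T⁻¹]⟦X⟧) hQ (n + 1)
    have e2 := X_pow_dvd_qPochInf_sub_qPoch (-X ^ (2 * m + 4) : ℤ[T;T⁻¹]⟦X⟧) hQ (n + 1)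
    obtain ⟨t, ht⟩ := X_pow_dvd_qPochInf_sub_qPoch (X ^ (2 * m + 3) : ℤ[T;T⁻¹]⟦X⟧) hQ (n + 1)
    rw [gf_distinct_progression (by omega) one_pos, pow_one, qPoch_two_mul, restSeries,
      show -X ^ (2 * m + 3) * X = (-X ^ (2 * m + 4) : ℤ[T;T⁻¹]⟦X⟧) by ring,
      show -X * (X ^ 2) ^ (m + 1) = (-X ^ (2 * m + 3) : ℤ[T;T⁻¹]⟦X⟧) by ring,
      show -1 * X ^ 2 * (X ^ 2) ^ (m + 1) = (-X ^ (2 * m + 4) : ℤ[T;T⁻¹]⟦X⟧) by ring,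
      show -X * -1 * (X ^ 2) ^ (m + 1) = (X ^ (2 * m + 3) : ℤ[T;T⁻¹]⟦X⟧) by ring, mul_comm,
      ← neg_sub, dvd_neg]
    refine X_pow_dvd_mul_sub_mul (X_pow_dvd_mul_sub_mul e1 e2) ?_
    set G := gf (partsWeight ((range (n + 1)).image fun j => 2 * m + 3 + 2 * j)
        (fun _ _ => (1 : ℤ[T;T⁻¹])))
    exact ⟨-(G * psInv (qPochInf (X ^ (2 * m + 3)) (X ^ 2)) * t), by
      linear_combination G * hinv - psInv (qPochInf (X ^ (2 * m + 3)) (X ^ 2)) * hg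
        - G * psInv (qPochInf (X ^ (2 * m + 3)) (X ^ 2)) * ht⟩

end SptSums

/-! ### Rank generating functions for h = 0. -/

section RankSeries

open PowerSeries Finset

/-- The inverse `1 / (x; Q)_n`. -/
noncomputable def invPoch {R : Type*} [CommRing R] (x Q : R⟦X⟧) (n : ℕ) : R⟦X⟧ :=
  psInv (qPochInf x Q) * qPochInf (x * Q ^ n) Q

theorem invPoch_eq_mul {R : Type*} [CommRing R] (x : R⟦X⟧) {Q : R⟦X⟧} (hQ : X ∣ Q) (n : ℕ) :
    invPoch x Q n = (1 - x * Q ^ n) * invPoch x Q (n + 1) := by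
  rw [invPoch, invPoch, qPochInf_eq_mul (x * Q ^ n) hQ, pow_succ]
  ring_nf

theorem eq_invPoch {R : Type*} [CommRing R] {x Q G : R⟦X⟧} (hQ : X ∣ Q) (hx : X ∣ x) {n : ℕ}
    (h : qPoch x Q n * G = 1) : G = invPoch x Q n := by
  have h1 := qPochInf_eq_qPoch_mul x hQ n
  have h2 := qPochInf_mul_psInv x Q hx
  rw [invPoch]
  linear_combination (psInv (qPochInf x Q) * qPochInf (x * Q ^ n) Q) * h - G * h2
    + G * psInv (qPochInf x Q) * h1

/-- The transformed generating function of the ranks. -/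
noncomputable def rankSeries (c N : ℕ) (α h : ℤ[T;T⁻¹]⟦X⟧) : ℤ[T;T⁻¹]⟦X⟧ :=
  1 + (1 - h) * (X ^ c - α) * ∑ l ∈ range N, (z * X ^ c) ^ l * qPoch (α * zInv) (X ^ c) l
    * qPoch (h * X ^ c * zInv) (X ^ c) l * invPoch (α * h) (X ^ c) (l + 1)
    * invPoch (zInv * X ^ c) (X ^ c) (l + 1)

theorem z_pow (l : ℕ) : z ^ l = C (LaurentPolynomial.T (l : ℤ)) := by
  rw [z, ← map_pow, LaurentPolynomial.T_pow, mul_one]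

theorem zInv_eq : C (LaurentPolynomial.T (-1)) = zInv := rfl

theorem T_neg_one_pow (l : ℕ) :
    (LaurentPolynomial.T (-1) : ℤ[T;T⁻¹]) ^ l = LaurentPolynomial.T (-(l : ℤ)) := by
  rw [LaurentPolynomial.T_pow, mul_neg_one]

theorem prod_map_const_T (s : Multiset ℕ) :
    (s.map fun _ => (LaurentPolynomial.T (-1) : ℤ[T;T⁻¹])).prod
      = LaurentPolynomial.T (-(Multiset.card s : ℤ)) := by
  rw [Multiset.map_const', Multiset.prod_replicate, T_neg_one_pow]

/-- Here c is the contribution of the largest part to the rank and v carries the rest; bounding c by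
l bounds the parts, so G l is a product. -/
theorem sum_T_rank {α : Type*} (S : Finset α) (c : α → ℕ) (v : α → ℤ[T;T⁻¹]) (N n : ℕ)
    (G : ℕ → ℤ[T;T⁻¹]⟦X⟧) (hc : ∀ x ∈ S, c x ≤ N)
    (hG : ∀ l, ∑ x ∈ S with c x ≤ l, v x = coeff n (G l)) :
    ∑ x ∈ S, LaurentPolynomial.T (c x : ℤ) * v x
      = coeff n (G 0 + ∑ l ∈ range N, z ^ (l + 1) * (G (l + 1) - G l)) := by
  rw [sum_layers S c (fun l => LaurentPolynomial.T (l : ℤ)) v N hc, map_add, map_sum, hG 0,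
    Nat.cast_zero, LaurentPolynomial.T_zero, one_mul]
  congr 1
  refine Finset.sum_congr rfl fun l _ => ?_
  rw [hG, hG, z_pow, coeff_C_mul, map_sub]

theorem mem_Icc_iff_of_pos {s : Multiset ℕ} (hs : ∀ i ∈ s, 0 < i) (L : ℕ) :
    (∀ i ∈ s, i ∈ Icc 1 L) ↔ s.sup ≤ L := by
  rw [Multiset.sup_le]
  exact forall₂_congr fun i hi => by rw [Finset.mem_Icc]; exact and_iff_right (hs i hi)

theorem sup_le_sum (s : Multiset ℕ) : s.sup ≤ s.sum :=
  Multiset.sup_le.2 fun _ hb => le_of_mem_of_sum_eq hb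

theorem gf_distinct_Icc (l : ℕ) :
    gf (partsWeight (Icc 1 l) (distinctWeight fun _ => LaurentPolynomial.T (-1)))
      = (qPoch (-X * zInv) X l : ℤ[T;T⁻¹]⟦X⟧) := by
  rw [gf_partsWeight _ fun i hi => (Finset.mem_Icc.1 hi).1]
  induction l with
  | zero => simp [qPoch_zero]
  | succ l ih =>
    rw [Finset.prod_Icc_succ_top (by omega), ih, qPoch_succ]
    congr 1
    refine (partSeries_distinct (by omega) _).trans ?_
    rw [zInv_eq]
    ring

theorem gf_pow_Icc (l : ℕ) :
    gf (partsWeight (Icc 1 l) fun _ f => LaurentPolynomial.T (-1) ^ f)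
      = (invPoch (zInv * X) X l : ℤ[T;T⁻¹]⟦X⟧) := by
  refine eq_invPoch dvd_rfl (dvd_mul_left _ _) ?_
  rw [gf_partsWeight _ fun i hi => (Finset.mem_Icc.1 hi).1]
  induction l with
  | zero => simp [qPoch_zero]
  | succ l ih =>
    have h2 := partSeries_geom (show 0 < l + 1 by omega)
      (LaurentPolynomial.T (-1) : ℤ[T;T⁻¹])
    rw [zInv_eq] at h2
    rw [Finset.prod_Icc_succ_top (by omega), qPoch_succ, mul_mul_mul_comm, ih, one_mul, mul_assoc,
      ← pow_succ', h2]

theorem invPoch_zero {R : Type*} [CommRing R] {x Q : R⟦X⟧} (hx : X ∣ x) :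
    invPoch x Q 0 = 1 := by
  rw [invPoch, pow_zero, mul_one, mul_comm, qPochInf_mul_psInv _ _ hx]

theorem zero_invPoch {R : Type*} [CommRing R] {Q : R⟦X⟧} (hQ : X ∣ Q) (n : ℕ) :
    invPoch 0 Q n = 1 := by
  simp [invPoch, qPochInf_zero hQ, psInv_one]

theorem zero_qPoch {R : Type*} [CommRing R] (Q : R⟦X⟧) (n : ℕ) : qPoch 0 Q n = 1 := by
  simp [qPoch]

theorem rank_layer_of_h_zero {A : Type*} [CommRing A] {z w : A} (hzw : z * w = 1)
    (x Q P B : A) (l : ℕ) :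
    z ^ (l + 1) * (P * (1 - -x * w * Q ^ l) * B - P * ((1 - w * Q * Q ^ l) * B))
      = (1 - 0) * (Q - -x) * ((z * Q) ^ l * P * 1 * 1 * B) := by
  rw [mul_pow]
  linear_combination (z ^ l * Q ^ l * (x + Q) * P * B) * hzw

/-- The layers agree term by term: (1 + xwQ^l) - (1 - wQ^{l+1}) = wQ^l (x + Q), and the factor w is
absorbed by z^{l+1}. -/
theorem rankSeries_of_h_zero {c : ℕ} (hc : 0 < c) (N : ℕ) :
    (qPoch (-X * zInv) (X ^ c) 0 * invPoch (zInv * X ^ c) (X ^ c) 0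
      + ∑ l ∈ range N, z ^ (l + 1) * (qPoch (-X * zInv) (X ^ c) (l + 1)
          * invPoch (zInv * X ^ c) (X ^ c) (l + 1)
        - qPoch (-X * zInv) (X ^ c) l * invPoch (zInv * X ^ c) (X ^ c) l))
      = rankSeries c N (-X) 0 := by
  have hQ : (X : ℤ[T;T⁻¹]⟦X⟧) ∣ X ^ c := dvd_pow_self X hc.ne'
  rw [rankSeries, Finset.mul_sum, qPoch_zero, invPoch_zero (hQ.mul_left zInv), mul_one]
  refine congrArg (1 + ·) (Finset.sum_congr rfl fun l _ => ?_)
  rw [zero_mul, zero_mul, mul_zero, zero_qPoch, zero_invPoch hQ, qPoch_succ,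
    invPoch_eq_mul (zInv * X ^ c) hQ l]
  exact rank_layer_of_h_zero z_mul_zInv _ _ _ _ l

theorem sum_T_dysonRank (n : ℕ) :
    ∑ π ∈ overpartitions n, LaurentPolynomial.T (dysonRank π)
      = coeff n (rankSeries 1 (n + 1) (-X) 0) := by
  rw [← rankSeries_of_h_zero one_pos]
  simp only [pow_one, ← gf_distinct_Icc, ← gf_pow_Icc]
  rw [← sum_T_rank (overpartitions n) (fun π => (π.1 + π.2).sup)
    (fun π => LaurentPolynomial.T (-(Multiset.card (π.1 + π.2) : ℤ))) (n + 1) n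
    (fun l => gf (partsWeight (Icc 1 l) (distinctWeight fun _ => LaurentPolynomial.T (-1)))
      * gf (partsWeight (Icc 1 l) fun _ f => LaurentPolynomial.T (-1) ^ f))]
  · refine Finset.sum_congr rfl fun π _ => ?_
    rw [dysonRank, sub_eq_add_neg, LaurentPolynomial.T_add]
  · intro π hπ
    obtain ⟨_, _, h⟩ := mem_partitionPairs.1 (Finset.mem_filter.1 hπ).1
    rw [Multiset.sup_add]
    exact sup_le ((sup_le_sum _).trans (by omega)) ((sup_le_sum _).trans (by omega))
  · intro l
    rw [mul_comm, ← sum_partitionPairs, overpartitions, Finset.filter_filter, Finset.sum_filter]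
    refine Finset.sum_congr rfl fun π hπ => ?_
    obtain ⟨h1, h2, h3⟩ := mem_partitionPairs.1 hπ
    rw [partsWeight_distinctWeight, partsWeight_pow (Icc 1 l) (fun _ => LaurentPolynomial.T (-1)),
      prod_map_const_T, prod_map_const_T, Multiset.card_add, Nat.cast_add, neg_add,
      LaurentPolynomial.T_add]
    simp only [mem_Icc_iff_of_pos h1, mem_Icc_iff_of_pos h2, Multiset.sup_add, sup_le_iff]
    rw [ite_zero_mul_ite_zero]
    exact if_congr (by tauto) rfl rfl

theorem ceil_half (l : ℕ) : ⌈(l : ℚ) / 2⌉ = (((l + 1) / 2 : ℕ) : ℤ) := by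
  rw [Int.ceil_eq_iff]
  rcases Nat.even_or_odd' l with ⟨m, rfl | rfl⟩
  · rw [show (2 * m + 1) / 2 = m by omega]
    push_cast
    constructor <;> linarith
  · rw [show (2 * m + 1 + 1) / 2 = m + 1 by omega]
    push_cast
    constructor <;> linarith

/-- The bound on the largest part is even because ⌈l(π)/2⌉ ≤ l means l(π) ≤ 2l; each induction step
adds one odd and one even part. -/
theorem gf_mixed_Icc (l : ℕ) :
    gf (partsWeight (Icc 1 (2 * l)) fun i f => if Odd i
        then distinctWeight (fun _ => LaurentPolynomial.T (-1)) i f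
        else LaurentPolynomial.T (-1) ^ f)
      = (qPoch (-X * zInv) (X ^ 2) l * invPoch (zInv * X ^ 2) (X ^ 2) l : ℤ[T;T⁻¹]⟦X⟧) := by
  have hQ : (X : ℤ[T;T⁻¹]⟦X⟧) ∣ X ^ 2 := dvd_pow_self X two_ne_zero
  rw [gf_partsWeight _ fun i hi => (Finset.mem_Icc.1 hi).1]
  induction l with
  | zero => simp [qPoch_zero, invPoch_zero (hQ.mul_left zInv)]
  | succ l ih =>
    have h2 := partSeries_geom (show 0 < 2 * l + 2 by omega) (LaurentPolynomial.T (-1) : ℤ[T;T⁻¹])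
    have h1 := partSeries_distinct (show 0 < 2 * l + 1 by omega)
      (LaurentPolynomial.T (-1) : ℤ[T;T⁻¹])
    rw [zInv_eq] at h1 h2
    have e1 : ¬ Odd (2 * l + 1 + 1) := by rw [Nat.odd_iff]; omega
    have e2 : Odd (2 * l + 1) := by rw [Nat.odd_iff]; omega
    rw [show 2 * (l + 1) = 2 * l + 1 + 1 by ring, Finset.prod_Icc_succ_top (by omega),
      Finset.prod_Icc_succ_top (by omega), ih, qPoch_succ, invPoch_eq_mul (zInv * X ^ 2) hQ l]
    simp only [e1, e2, if_true, if_false]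
    simp only [distinctWeight]
    rw [h1]
    rw [show 1 - zInv * X ^ 2 * (X ^ 2) ^ l = 1 - zInv * X ^ (2 * l + 2) by ring,
      show 1 - -X * zInv * (X ^ 2) ^ l = 1 + zInv * X ^ (2 * l + 1) by ring]
    linear_combination (qPoch (-X * zInv) (X ^ 2) l * invPoch (zInv * X ^ 2) (X ^ 2) (l + 1)
      * (1 + zInv * X ^ (2 * l + 1))) * h2

theorem sum_T_m2Rank (n : ℕ) :
    ∑ s ∈ distinctOddPartitions n, LaurentPolynomial.T (m2Rank s)
      = coeff n (rankSeries 2 (n + 1) (-X) 0) := by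
  rw [← rankSeries_of_h_zero two_pos]
  simp only [← gf_mixed_Icc]
  rw [← sum_T_rank (distinctOddPartitions n) (fun s => (s.sup + 1) / 2)
    (fun s => LaurentPolynomial.T (-(Multiset.card s : ℤ))) (n + 1) n
    (fun l => gf (partsWeight (Icc 1 (2 * l)) fun i f => if Odd i
        then distinctWeight (fun _ => LaurentPolynomial.T (-1)) i f
        else LaurentPolynomial.T (-1) ^ f))]
  · refine Finset.sum_congr rfl fun s _ => ?_
    rw [m2Rank, sub_eq_add_neg, LaurentPolynomial.T_add, ceil_half]
  · intro s hs
    have h := (mem_partitionsOf.1 (Finset.mem_filter.1 hs).1).2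
    have := sup_le_sum s
    omega
  · intro l
    rw [coeff_gf, distinctOddPartitions, Finset.filter_filter, Finset.sum_filter]
    refine Finset.sum_congr rfl fun s hs => ?_
    have h1 := (mem_partitionsOf.1 hs).1
    rw [partsWeight_mixed (Icc 1 (2 * l)) Odd (fun _ => LaurentPolynomial.T (-1)),
      prod_map_const_T]
    simp only [mem_Icc_iff_of_pos h1, show (s.sup + 1) / 2 ≤ l ↔ s.sup ≤ 2 * l by omega,
      and_comm]

end RankSeries

/-! ### The M₂-rank of overpartitions, h = -1. -/

section RankSeriesTwo

open PowerSeries Finset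

/-- The weight of a non-overlined part in the `M₂`-rank of an overpartition. -/
noncomputable def oddFreeWeight (i : ℕ) : ℤ[T;T⁻¹] :=
  if Odd i then 1 else LaurentPolynomial.T (-1)

theorem prod_map_oddFreeWeight (s : Multiset ℕ) :
    (s.map oddFreeWeight).prod
      = LaurentPolynomial.T (-(Multiset.card s : ℤ) + Multiset.card (s.filter Odd)) := by
  induction s using Multiset.induction_on with
  | empty => simp
  | cons a s ih =>
    rw [Multiset.map_cons, Multiset.prod_cons, ih, Multiset.card_cons, oddFreeWeight]
    split_ifs with h
    · rw [Multiset.filter_cons_of_pos _ h, Multiset.card_cons, one_mul]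
      congr 1
      push_cast
      ring
    · rw [Multiset.filter_cons_of_neg _ h, ← LaurentPolynomial.T_add]
      congr 1
      push_cast
      ring

theorem gf_distinct_Icc_two_mul (l : ℕ) :
    gf (partsWeight (Icc 1 (2 * l)) (distinctWeight fun _ => LaurentPolynomial.T (-1)))
      = (qPoch (-X * zInv) (X ^ 2) l * qPoch (-1 * X ^ 2 * zInv) (X ^ 2) l : ℤ[T;T⁻¹]⟦X⟧) := by
  rw [gf_distinct_Icc, qPoch_two_mul, show -X * zInv * X = -1 * X ^ 2 * zInv by ring]

/-- Non-overlined odd parts have weight 1, since #(π_o) cancels their count in #(π); hence a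
denominator without z⁻¹. -/
theorem gf_oddFree_Icc (l : ℕ) :
    gf (partsWeight (Icc 1 (2 * l + 1)) fun i f => oddFreeWeight i ^ f)
      = (invPoch X (X ^ 2) (l + 1) * invPoch (zInv * X ^ 2) (X ^ 2) l : ℤ[T;T⁻¹]⟦X⟧) := by
  have hQ : (X : ℤ[T;T⁻¹]⟦X⟧) ∣ X ^ 2 := dvd_pow_self X two_ne_zero
  have hodd : ∀ j, (1 - X * (X ^ 2) ^ j)
      * partSeries (2 * j + 1) (fun f => oddFreeWeight (2 * j + 1) ^ f) = 1 := by
    intro j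
    have h := partSeries_geom (show 0 < 2 * j + 1 by omega) (oddFreeWeight (2 * j + 1))
    rw [show oddFreeWeight (2 * j + 1) = 1 from if_pos (by simp)] at h ⊢
    rwa [map_one, one_mul, pow_succ', pow_mul] at h
  rw [gf_partsWeight _ fun i hi => (Finset.mem_Icc.1 hi).1]
  induction l with
  | zero =>
    rw [invPoch_zero (hQ.mul_left zInv), mul_one]
    refine eq_invPoch hQ dvd_rfl ?_
    simpa [qPoch] using hodd 0
  | succ l ih =>
    have h1 := hodd (l + 1)
    have h2 := partSeries_geom (show 0 < 2 * l + 1 + 1 by omega) (oddFreeWeight (2 * l + 1 + 1))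
    have e1 : oddFreeWeight (2 * l + 1 + 1) = LaurentPolynomial.T (-1) :=
      if_neg (by rw [Nat.odd_iff]; omega)
    rw [e1, zInv_eq] at h2
    rw [show 2 * (l + 1) + 1 = 2 * l + 1 + 1 + 1 by ring] at h1 ⊢
    rw [Finset.prod_Icc_succ_top (by omega), Finset.prod_Icc_succ_top (by omega), ih,
      invPoch_eq_mul X hQ (l + 1), invPoch_eq_mul (zInv * X ^ 2) hQ l, e1]
    rw [show 1 - zInv * X ^ 2 * (X ^ 2) ^ l = 1 - zInv * X ^ (2 * l + 1 + 1) by ring]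
    linear_combination (invPoch X (X ^ 2) (l + 1 + 1) * invPoch (zInv * X ^ 2) (X ^ 2) (l + 1))
      * ((1 - X * (X ^ 2) ^ (l + 1)) * partSeries (2 * l + 1 + 1 + 1)
        (fun f => oddFreeWeight (2 * l + 1 + 1 + 1) ^ f) * h2 + h1)

/-- The two brackets correspond to raising the bound on non-overlined parts from 2l to 2l + 1, and
then both bounds to 2l + 2; only together do they form one term of the rank series. -/
theorem rank_layer_of_h_neg_one {A : Type*} [CommRing A] {z w : A} (hzw : z * w = 1)
    (x P₁ P₂ I J : A) (l : ℕ) :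
    z ^ (l + 1) * (P₁ * (1 - -x * w * (x ^ 2) ^ l) * (P₂ * (1 - -1 * x ^ 2 * w * (x ^ 2) ^ l)) * (I * J)
        - P₁ * P₂ * (I * ((1 - w * x ^ 2 * (x ^ 2) ^ l) * J)))
      + z ^ l * (P₁ * P₂ * (I * ((1 - w * x ^ 2 * (x ^ 2) ^ l) * J))
        - P₁ * P₂ * ((1 - x * (x ^ 2) ^ l) * I * ((1 - w * x ^ 2 * (x ^ 2) ^ l) * J)))
      = (1 - -1) * (x ^ 2 - -x) * ((z * x ^ 2) ^ l * P₁ * P₂ * I * J) := by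
  rw [mul_pow]
  linear_combination (z ^ l * P₁ * P₂ * I * J
    * (x * x ^ (2 * l) + 2 * x ^ 2 * x ^ (2 * l) + x ^ 3 * x ^ (4 * l) * w)) * hzw

/-- In the application D l allows non-overlined parts up to 2l + 1 and E l only up to 2l, with
overlined parts up to 2l in both. -/
theorem regroup_layers {A : Type*} [CommRing A] (z : A) (D E : ℕ → A) (hE : E 0 = 1) (N : ℕ) :
    D 0 + ∑ l ∈ range N, z ^ (l + 1) * (D (l + 1) - D l)
      = 1 + ∑ l ∈ range N, (z ^ (l + 1) * (E (l + 1) - D l) + z ^ l * (D l - E l))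
        + z ^ N * (D N - E N) := by
  induction N with
  | zero => simp [hE]
  | succ N ih =>
    rw [Finset.sum_range_succ, Finset.sum_range_succ]
    linear_combination ih

theorem rankSeries_of_h_neg_one (N : ℕ) :
    X ^ N ∣ (qPoch (-X * zInv) (X ^ 2) 0 * qPoch (-1 * X ^ 2 * zInv) (X ^ 2) 0
          * (invPoch X (X ^ 2) (0 + 1) * invPoch (zInv * X ^ 2) (X ^ 2) 0)
        + ∑ l ∈ range N, z ^ (l + 1) * (qPoch (-X * zInv) (X ^ 2) (l + 1)
            * qPoch (-1 * X ^ 2 * zInv) (X ^ 2) (l + 1)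
            * (invPoch X (X ^ 2) (l + 1 + 1) * invPoch (zInv * X ^ 2) (X ^ 2) (l + 1))
          - qPoch (-X * zInv) (X ^ 2) l * qPoch (-1 * X ^ 2 * zInv) (X ^ 2) l
            * (invPoch X (X ^ 2) (l + 1) * invPoch (zInv * X ^ 2) (X ^ 2) l)))
      - rankSeries 2 N (-X) (-1) := by
  have hQ : (X : ℤ[T;T⁻¹]⟦X⟧) ∣ X ^ 2 := dvd_pow_self X two_ne_zero
  rw [regroup_layers z (fun l => qPoch (-X * zInv) (X ^ 2) l * qPoch (-1 * X ^ 2 * zInv) (X ^ 2) l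
      * (invPoch X (X ^ 2) (l + 1) * invPoch (zInv * X ^ 2) (X ^ 2) l))
    (fun l => qPoch (-X * zInv) (X ^ 2) l * qPoch (-1 * X ^ 2 * zInv) (X ^ 2) l
      * (invPoch X (X ^ 2) l * invPoch (zInv * X ^ 2) (X ^ 2) l))
    (by rw [qPoch_zero, qPoch_zero, invPoch_zero dvd_rfl, invPoch_zero (hQ.mul_left zInv), mul_one,
      mul_one]) N]
  have hrank : rankSeries 2 N (-X) (-1) = 1 + ∑ l ∈ range N,
      (z ^ (l + 1) * (qPoch (-X * zInv) (X ^ 2) (l + 1) * qPoch (-1 * X ^ 2 * zInv) (X ^ 2) (l + 1)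
          * (invPoch X (X ^ 2) (l + 1) * invPoch (zInv * X ^ 2) (X ^ 2) (l + 1))
        - qPoch (-X * zInv) (X ^ 2) l * qPoch (-1 * X ^ 2 * zInv) (X ^ 2) l
          * (invPoch X (X ^ 2) (l + 1) * invPoch (zInv * X ^ 2) (X ^ 2) l))
      + z ^ l * (qPoch (-X * zInv) (X ^ 2) l * qPoch (-1 * X ^ 2 * zInv) (X ^ 2) l
          * (invPoch X (X ^ 2) (l + 1) * invPoch (zInv * X ^ 2) (X ^ 2) l)
        - qPoch (-X * zInv) (X ^ 2) l * qPoch (-1 * X ^ 2 * zInv) (X ^ 2) l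
          * (invPoch X (X ^ 2) l * invPoch (zInv * X ^ 2) (X ^ 2) l))) := by
    rw [rankSeries, Finset.mul_sum]
    refine congrArg (1 + ·) (Finset.sum_congr rfl fun l _ => ?_)
    rw [neg_mul_neg, mul_one, qPoch_succ, qPoch_succ, invPoch_eq_mul X hQ l,
      invPoch_eq_mul (zInv * X ^ 2) hQ l]
    exact (rank_layer_of_h_neg_one z_mul_zInv _ _ _ _ _ l).symm
  -- The boundary term z^N (D N - E N) counts overpartitions with a non-overlined part 2N + 1, so it
  -- is divisible by X · (X²)^N; hence a congruence rather than an equality.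
  rw [hrank, add_sub_cancel_left, ← mul_sub, ← sub_mul, invPoch_eq_mul X hQ N]
  refine dvd_mul_of_dvd_right (dvd_mul_of_dvd_right (dvd_mul_of_dvd_left ?_ _) _) _
  rw [← one_sub_mul, sub_sub_cancel]
  exact ((pow_dvd_pow_of_dvd hQ N).mul_left X).mul_right _

theorem sum_T_m2RankOver (n : ℕ) :
    ∑ π ∈ overpartitions n, LaurentPolynomial.T (m2RankOver π)
      = coeff n (rankSeries 2 (n + 1) (-X) (-1)) := by
  rw [← coeff_eq_of_X_pow_dvd_sub (rankSeries_of_h_neg_one (n + 1))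
    (Nat.lt_add_one n)]
  simp only [← gf_distinct_Icc_two_mul, ← gf_oddFree_Icc]
  rw [← sum_T_rank (overpartitions n) (fun π => ((π.1 + π.2).sup + 1) / 2
      - if Odd (π.1 + π.2).sup ∧ (π.1 + π.2).sup ∉ π.2 then 1 else 0)
    (fun π => LaurentPolynomial.T (-(Multiset.card (π.1 + π.2) : ℤ)
      + Multiset.card (π.1.filter Odd))) (n + 1) n
    (fun l => gf (partsWeight (Icc 1 (2 * l)) (distinctWeight fun _ => LaurentPolynomial.T (-1)))
      * gf (partsWeight (Icc 1 (2 * l + 1)) fun i f => oddFreeWeight i ^ f))]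
  · refine Finset.sum_congr rfl fun π _ => ?_
    rw [m2RankOver, ceil_half, ← LaurentPolynomial.T_add]
    congr 1
    -- The natural subtraction is exact: if 1 is subtracted, the largest part is odd, hence
    -- positive.
    split_ifs with h
    · have := Nat.odd_iff.1 h.1
      push_cast
      omega
    · rw [Nat.sub_zero]
      ring
  · intro π hπ
    obtain ⟨_, _, h⟩ := mem_partitionPairs.1 (Finset.mem_filter.1 hπ).1
    have : (π.1 + π.2).sup ≤ n := by
      rw [Multiset.sup_add]
      exact sup_le ((sup_le_sum _).trans (by omega)) ((sup_le_sum _).trans (by omega))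
    omega
  · intro l
    rw [mul_comm, ← sum_partitionPairs, overpartitions, Finset.filter_filter, Finset.sum_filter]
    refine Finset.sum_congr rfl fun π hπ => ?_
    obtain ⟨h1, h2, h3⟩ := mem_partitionPairs.1 hπ
    -- The role of χ: largest part 2l + 1 has half-ceiling l + 1, and stays in layer l exactly when
    -- no occurrence of it is overlined.
    have key : ((π.1 + π.2).sup + 1) / 2
        - (if Odd (π.1 + π.2).sup ∧ (π.1 + π.2).sup ∉ π.2 then 1 else 0) ≤ l
        ↔ π.1.sup ≤ 2 * l + 1 ∧ π.2.sup ≤ 2 * l := by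
      have hmem : π.2.sup ≤ 2 * l + 1 → (2 * l + 1 ∉ π.2 ↔ π.2.sup ≤ 2 * l) := by
        intro hle
        constructor
        · intro h
          refine Multiset.sup_le.2 fun b hb => ?_
          have := (Multiset.le_sup hb).trans hle
          have : b ≠ 2 * l + 1 := fun h' => h (h' ▸ hb)
          omega
        · intro h hb
          have := (Multiset.le_sup hb).trans h
          omega
      rw [Multiset.sup_add]
      simp only [Nat.odd_iff]
      generalize hs : π.1.sup ⊔ π.2.sup = M
      have hM1 : π.1.sup ≤ M := hs ▸ le_sup_left
      have hM2 : π.2.sup ≤ M := hs ▸ le_sup_right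
      have hM : M = π.1.sup ∨ M = π.2.sup := by
        rw [← hs]
        exact max_choice _ _
      by_cases hMl : M = 2 * l + 1
      · subst hMl
        have := hmem hM2
        split_ifs with h
        · have := this.1 h.2
          omega
        · have : 2 * l + 1 ∈ π.2 := by
            by_contra h'
            exact h ⟨by omega, h'⟩
          have := Multiset.le_sup this
          omega
      · split_ifs <;> omega
    rw [partsWeight_distinctWeight, partsWeight_pow (Icc 1 (2 * l + 1)) oddFreeWeight,
      prod_map_const_T, prod_map_oddFreeWeight, ite_zero_mul_ite_zero, ← LaurentPolynomial.T_add]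
    simp only [mem_Icc_iff_of_pos h1, mem_Icc_iff_of_pos h2, key]
    refine if_congr (by tauto) ?_ rfl
    congr 1
    rw [Multiset.card_add]
    push_cast
    ring

end RankSeriesTwo

/-! ### The three identities for general k. -/

section Assembly

open PowerSeries Finset

theorem shiftMoment_crank_sub_rank {c : ℕ} (hc : 0 < c) (h : ℤ[T;T⁻¹]⟦X⟧) (n : ℕ)
    (L : ℤ[T;T⁻¹] →+ ℤ) :
    L (coeff n (restSeries (X ^ c) (-X) h 0 * qPochInf (X ^ c) (X ^ c)
        * psInv (qPochInf (z * X ^ c) (X ^ c)) * psInv (qPochInf (zInv * X ^ c) (X ^ c))))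
      - L (coeff n (rankSeries c (n + 1) (-X) h)) = L (coeff n (sptSeries c (n + 1) (-X) h)) := by
  have hd := crank_sub_rank (h := h) (dvd_pow_self (X : ℤ[T;T⁻¹]⟦X⟧) hc.ne')
    ((dvd_neg (α := ℤ[T;T⁻¹]⟦X⟧)).2 dvd_rfl) z_mul_zInv (n + 1)
  rw [← map_sub, ← map_sub]
  exact congrArg L (coeff_eq_of_X_pow_dvd_sub hd (Nat.lt_add_one n))

theorem M2spt_eq_sum {k : ℕ} (hk : 1 ≤ k) (n : ℕ) :
    M2spt k n = ∑ π ∈ S2 n, (omega k π.1 : ℤ) := by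
  have hQ : (X : ℤ[T;T⁻¹]⟦X⟧) ∣ X ^ 2 := dvd_pow_self X two_ne_zero
  have hc : crankSeries2 = restSeries (X ^ 2) (-X) 0 0 * qPochInf (X ^ 2) (X ^ 2)
      * psInv (qPochInf (z * X ^ 2) (X ^ 2)) * psInv (qPochInf (zInv * X ^ 2) (X ^ 2)) := by
    rw [restSeries_of_zero hQ, pow_zero, mul_one]
    rfl
  rw [sum_S2 hk, ← shiftMoment_crank_sub_rank two_pos, ← hc, ← sum_T_m2Rank, ← symMoment_coeff,
    ← symMoment_card]
  rfl

theorem sptBar_eq_sum {k : ℕ} (hk : 1 ≤ k) (n : ℕ) :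
    sptBar k n = ∑ π ∈ SBar n, (omega k π.1 : ℤ) := by
  have hc : crankSeriesBar = restSeries (X ^ 1) (-X) 0 0 * qPochInf (X ^ 1) (X ^ 1)
      * psInv (qPochInf (z * X ^ 1) (X ^ 1)) * psInv (qPochInf (zInv * X ^ 1) (X ^ 1)) := by
    rw [pow_one, restSeries_of_zero dvd_rfl, pow_zero, mul_one]
    rfl
  rw [sum_SBar hk, ← shiftMoment_crank_sub_rank one_pos, ← hc, ← sum_T_dysonRank,
    ← symMoment_coeff, ← symMoment_card]
  rfl

/-- With α = -q, h = -1 and Q = q² the numerator (-q; q²)_∞ (-q²; q²)_∞ recombines to (-q; q)_∞, and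
αh = q gives the denominator (q; q²)_∞. -/
theorem sptBar2_eq_sum {k : ℕ} (hk : 1 ≤ k) (n : ℕ) :
    sptBar2 k n = ∑ π ∈ SBar2 n, (omega k π.1 : ℤ) := by
  have hc : crankSeries2Bar = restSeries (X ^ 2) (-X) (-1) 0 * qPochInf (X ^ 2) (X ^ 2)
      * psInv (qPochInf (z * X ^ 2) (X ^ 2)) * psInv (qPochInf (zInv * X ^ 2) (X ^ 2)) := by
    rw [crankSeries2Bar, restSeries, pow_zero, mul_one, mul_one, mul_one, neg_mul_neg, mul_one,
      show -1 * X ^ 2 = -X * (X : ℤ[T;T⁻¹]⟦X⟧) by ring, ← qPochInf_eq_mul_sq _ dvd_rfl,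
      mul_right_comm (qPochInf (-q) q)]
    rfl
  rw [sum_SBar2 hk, ← shiftMoment_crank_sub_rank two_pos, ← hc, ← sum_T_m2RankOver,
    ← symMoment_coeff, ← symMoment_card]
  rfl

/-! ### The case k = 1: counting occurrences of the smallest part. -/

theorem exists_smallest {s : Multiset ℕ} (hs : s ≠ 0) :
    smallestPart s ∈ s ∧ ∀ b ∈ s, smallestPart s ≤ b := by
  have hne : s.toFinset.Nonempty := Multiset.toFinset_nonempty.2 hs
  have hmem := Multiset.mem_toFinset.1 (s.toFinset.min'_mem hne)
  have hmin : ∀ b ∈ s, s.toFinset.min' hne ≤ b := fun b hb =>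
    s.toFinset.min'_le b (Multiset.mem_toFinset.2 hb)
  rw [smallestPart_eq hmem hmin]
  exact ⟨hmem, hmin⟩

theorem smallestPart_add {s t : Multiset ℕ} {a : ℕ} (ha : a ∈ s) (hs : ∀ b ∈ s, a ≤ b)
    (ht : ∀ b ∈ t, a < b) : smallestPart (s + t) = a ∧ (s + t).count a = omega 1 s := by
  constructor
  · refine smallestPart_eq (Multiset.mem_add.2 (Or.inl ha)) fun b hb => ?_
    rcases Multiset.mem_add.1 hb with h | h
    · exact hs b h
    · exact (ht b h).le
  · rw [omega_one ha hs, Multiset.count_add,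
      Multiset.count_eq_zero_of_notMem fun h => (ht a h).false, add_zero]

theorem exists_smallest_of_sum {s t : Multiset ℕ} {n : ℕ} (hn : 1 ≤ n)
    (h : s.sum + t.sum = n) (ht : smallestPart (s + t) ∉ t) :
    smallestPart (s + t) ∈ s ∧ (∀ b ∈ s, smallestPart (s + t) ≤ b) ∧
      ∀ b ∈ t, smallestPart (s + t) < b := by
  have hne : s + t ≠ 0 := by
    intro h0
    have := congrArg Multiset.sum h0
    rw [Multiset.sum_add, Multiset.sum_zero] at this
    omega
  obtain ⟨h1, h2⟩ := exists_smallest hne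
  refine ⟨(Multiset.mem_add.1 h1).resolve_right ht, fun b hb => h2 b (Multiset.mem_add.2 (.inl hb)),
    fun b hb => lt_of_le_of_ne (h2 b (Multiset.mem_add.2 (.inr hb))) ?_⟩
  rintro rfl
  exact ht hb

theorem filter_even_add_filter_odd (s : Multiset ℕ) : s.filter Even + s.filter Odd = s := by
  conv_rhs => rw [← Multiset.filter_add_not Even s]
  congr 1
  exact Multiset.filter_congr fun _ _ => Nat.not_even_iff_odd.symm

theorem filter_even_add {s t : Multiset ℕ} (hs : ∀ i ∈ s, Even i) (ht : ∀ i ∈ t, Odd i) :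
    (s + t).filter Even = s ∧ (s + t).filter Odd = t := by
  rw [Multiset.filter_add, Multiset.filter_add, Multiset.filter_eq_self.2 hs,
    Multiset.filter_eq_self.2 ht, Multiset.filter_eq_nil.2 fun i hi => Nat.not_even_iff_odd.2 (ht i hi),
    Multiset.filter_eq_nil.2 fun i hi => Nat.not_odd_iff_even.2 (hs i hi), add_zero, zero_add]
  exact ⟨rfl, rfl⟩

/-- The positivity of n matters: the empty overpartition would belong only to the right-hand side.
-/
theorem SBar_eq {n : ℕ} (hn : 1 ≤ n) :
    SBar n = (overpartitions n).filter fun π => smallestPart (π.1 + π.2) ∉ π.2 := by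
  rw [SBar, overpartitions, Finset.filter_filter]
  refine Finset.filter_congr fun π hπ => and_congr_right fun _ => ?_
  obtain ⟨_, _, h3⟩ := mem_partitionPairs.1 hπ
  constructor
  · rintro ⟨a, ha, hmin, hlow⟩ hmem
    rw [(smallestPart_add (Multiset.mem_toFinset.1 ha) hmin hlow).1] at hmem
    exact (hlow a hmem).false
  · intro h
    obtain ⟨h4, h5, h6⟩ := exists_smallest_of_sum hn h3 h
    exact ⟨_, Multiset.mem_toFinset.2 h4, h5, h6⟩

theorem sum_SBar_omega_one {n : ℕ} (hn : 1 ≤ n) : ∑ π ∈ SBar n, omega 1 π.1 = ordSptBar n := by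
  rw [ordSptBar, ← SBar_eq hn]
  refine Finset.sum_congr rfl fun π hπ => ?_
  obtain ⟨_, _, a, ha, hmin, hlow⟩ := Finset.mem_filter.1 hπ
  obtain ⟨h1, h2⟩ := smallestPart_add (Multiset.mem_toFinset.1 ha) hmin hlow
  rw [h1, h2]

/-- The pairs are the partitions split by parity; an even smallest part cannot occur in the odd
component. -/
theorem sum_S2_omega_one {n : ℕ} (hn : 1 ≤ n) : ∑ π ∈ S2 n, omega 1 π.1 = ordM2spt n := by
  rw [ordM2spt]
  refine Finset.sum_bij' (fun π _ => π.1 + π.2) (fun s _ => (s.filter Even, s.filter Odd))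
    ?_ ?_ ?_ ?_ ?_
  · intro π hπ
    obtain ⟨hp, heven, hodd, hnd, a, ha, hmin, hlow⟩ := Finset.mem_filter.1 hπ
    obtain ⟨h1, h2, h3⟩ := mem_partitionPairs.1 hp
    rw [Multiset.mem_toFinset] at ha
    rw [Finset.mem_filter, distinctOddPartitions, Finset.mem_filter, mem_partitionsOf,
      (smallestPart_add ha hmin hlow).1, Multiset.sum_add]
    refine ⟨⟨⟨fun i hi => ?_, h3⟩, fun i hi ho => ?_⟩, heven a ha⟩
    · rcases Multiset.mem_add.1 hi with h | h
      · exact h1 i h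
      · exact h2 i h
    · have hi1 : i ∉ π.1 := fun h => Nat.not_even_iff_odd.2 ho (heven i h)
      rw [Multiset.count_add, Multiset.count_eq_zero_of_notMem hi1, zero_add]
      exact Multiset.count_eq_one_of_mem hnd ((Multiset.mem_add.1 hi).resolve_left hi1)
  · intro s hs
    obtain ⟨hs', hev⟩ := Finset.mem_filter.1 hs
    obtain ⟨hp, hcount⟩ := Finset.mem_filter.1 hs'
    obtain ⟨hpos, hsum⟩ := mem_partitionsOf.1 hp
    have hsplit := filter_even_add_filter_odd s
    have hsum' : (s.filter Even).sum + (s.filter Odd).sum = n := by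
      rw [← Multiset.sum_add, hsplit, hsum]
    rw [S2, Finset.mem_filter, mem_partitionPairs]
    refine ⟨⟨fun i hi => hpos i (Multiset.mem_filter.1 hi).1,
      fun i hi => hpos i (Multiset.mem_filter.1 hi).1, hsum'⟩,
      fun i hi => (Multiset.mem_filter.1 hi).2, fun i hi => (Multiset.mem_filter.1 hi).2,
      Multiset.nodup_iff_count_eq_one.2 fun i hi => ?_, ?_⟩
    · rw [Multiset.mem_filter] at hi
      rw [Multiset.count_filter_of_pos hi.2, hcount i hi.1 hi.2]
    · obtain ⟨h4, h5, h6⟩ := exists_smallest_of_sum hn hsum' (by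
        rw [hsplit]
        exact fun h => Nat.not_even_iff_odd.2 (Multiset.mem_filter.1 h).2 hev)
      exact ⟨_, Multiset.mem_toFinset.2 h4, h5, h6⟩
  · intro π hπ
    obtain ⟨_, heven, hodd, _⟩ := Finset.mem_filter.1 hπ
    obtain ⟨h1, h2⟩ := filter_even_add heven hodd
    exact Prod.ext h1 h2
  · intro s _
    exact filter_even_add_filter_odd s
  · intro π hπ
    obtain ⟨_, _, _, _, a, ha, hmin, hlow⟩ := Finset.mem_filter.1 hπ
    obtain ⟨h1, h2⟩ := smallestPart_add (Multiset.mem_toFinset.1 ha) hmin hlow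
    rw [h1, h2]

/-- Merging the first two components is undone by splitting the non-overlined parts by parity. -/
theorem sum_SBar2_omega_one {n : ℕ} (hn : 1 ≤ n) :
    ∑ π ∈ SBar2 n, omega 1 π.1 = ordSptBar2 n := by
  rw [ordSptBar2]
  have hlow' : ∀ {s t : Multiset ℕ} {a : ℕ}, (∀ b ∈ s, a < b) → (∀ b ∈ t, a < b) →
      ∀ b ∈ s + t, a < b := fun hs ht b hb => (Multiset.mem_add.1 hb).elim (hs b) (ht b)
  refine Finset.sum_bij' (fun π _ => (π.1 + π.2.1, π.2.2))
    (fun π _ => (π.1.filter Even, π.1.filter Odd, π.2)) ?_ ?_ ?_ ?_ ?_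
  · intro π hπ
    obtain ⟨hp, heven, hodd, hnd, a, ha, hmin, hlow1, hlow2⟩ := Finset.mem_filter.1 hπ
    obtain ⟨h1, h2, h3, h4⟩ := mem_partitionTriples.1 hp
    rw [Multiset.mem_toFinset] at ha
    rw [Finset.mem_filter, overpartitions, Finset.mem_filter, mem_partitionPairs]
    simp only [add_assoc, (smallestPart_add ha hmin (hlow' hlow1 hlow2)).1, Multiset.sum_add]
    refine ⟨⟨⟨fun i hi => ?_, h3, by omega⟩, hnd⟩, heven a ha, fun h => (hlow2 a h).false⟩
    rcases Multiset.mem_add.1 hi with h | h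
    · exact h1 i h
    · exact h2 i h
  · intro π hπ
    obtain ⟨hπ', hev, hnot⟩ := Finset.mem_filter.1 hπ
    obtain ⟨hp, hnd⟩ := Finset.mem_filter.1 hπ'
    obtain ⟨h1, h2, h3⟩ := mem_partitionPairs.1 hp
    have hsplit := filter_even_add_filter_odd π.1
    have hsum : (π.1.filter Even).sum + (π.1.filter Odd).sum = π.1.sum := by
      rw [← Multiset.sum_add, hsplit]
    rw [SBar2, Finset.mem_filter, mem_partitionTriples]
    refine ⟨⟨fun i hi => h1 i (Multiset.mem_filter.1 hi).1,
      fun i hi => h1 i (Multiset.mem_filter.1 hi).1, h2,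
      (congrArg (· + π.2.sum) hsum).trans h3⟩,
      fun i hi => (Multiset.mem_filter.1 hi).2, fun i hi => (Multiset.mem_filter.1 hi).2, hnd, ?_⟩
    have hassoc : π.1.filter Even + (π.1.filter Odd + π.2) = π.1 + π.2 := by
      rw [← add_assoc, hsplit]
    obtain ⟨h4, h5, h6⟩ := exists_smallest_of_sum (s := π.1.filter Even)
      (t := π.1.filter Odd + π.2) hn (by rw [Multiset.sum_add]; omega) (by
        rw [hassoc, Multiset.mem_add]
        rintro (h | h)
        · exact Nat.not_even_iff_odd.2 (Multiset.mem_filter.1 h).2 hev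
        · exact hnot h)
    exact ⟨_, Multiset.mem_toFinset.2 h4, h5, fun b hb => h6 b (Multiset.mem_add.2 (.inl hb)),
      fun b hb => h6 b (Multiset.mem_add.2 (.inr hb))⟩
  · intro π hπ
    obtain ⟨_, heven, hodd, _⟩ := Finset.mem_filter.1 hπ
    obtain ⟨h1, h2⟩ := filter_even_add heven hodd
    exact Prod.ext h1 (Prod.ext h2 rfl)
  · intro π _
    exact Prod.ext (filter_even_add_filter_odd π.1) rfl
  · intro π hπ
    obtain ⟨_, _, _, _, a, ha, hmin, hlow1, hlow2⟩ := Finset.mem_filter.1 hπ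
    obtain ⟨h1, h2⟩ := smallestPart_add (Multiset.mem_toFinset.1 ha) hmin (hlow' hlow1 hlow2)
    simp only [add_assoc]
    rw [h1, h2]

end Assembly
end HigherSpt

theorem mainTheorem6 :
    (∀ k n : ℕ, 1 ≤ k → 1 ≤ n →
      HigherSpt.M2spt k n = ∑ π ∈ HigherSpt.S2 n, (HigherSpt.omega k π.1 : ℤ) ∧
      HigherSpt.sptBar k n = ∑ π ∈ HigherSpt.SBar n, (HigherSpt.omega k π.1 : ℤ) ∧
      HigherSpt.sptBar2 k n = ∑ π ∈ HigherSpt.SBar2 n, (HigherSpt.omega k π.1 : ℤ)) ∧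
    (∀ n : ℕ, 1 ≤ n →
      HigherSpt.M2spt 1 n = (HigherSpt.ordM2spt n : ℤ) ∧
      HigherSpt.sptBar 1 n = (HigherSpt.ordSptBar n : ℤ) ∧
      HigherSpt.sptBar2 1 n = (HigherSpt.ordSptBar2 n : ℤ)) := by
  refine ⟨fun k n hk _ => ⟨HigherSpt.M2spt_eq_sum hk n, HigherSpt.sptBar_eq_sum hk n,
    HigherSpt.sptBar2_eq_sum hk n⟩, fun n hn => ⟨?_, ?_, ?_⟩⟩
  · rw [HigherSpt.M2spt_eq_sum le_rfl, ← HigherSpt.sum_S2_omega_one hn, Nat.cast_sum]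
  · rw [HigherSpt.sptBar_eq_sum le_rfl, ← HigherSpt.sum_SBar_omega_one hn, Nat.cast_sum]
  · rw [HigherSpt.sptBar2_eq_sum le_rfl, ← HigherSpt.sum_SBar2_omega_one hn, Nat.cast_sum]
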